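/- Let $d\ge 2$, $1<\alpha<2$, $1<q<d+\alpha$ and $1<p<\infty$, and write points of $\mathbb R^{d+1}$ as $(t,x)$ with $t\in\mathbb R$, $x\in\mathbb R^d$. For $\rho>0$ let $C_\rho(t,x)=\{(s,y): t\le s\le t+\rho^\alpha,\ |y-x|\le\rho\}$. A function $v\in L^q_{\rm loc}(\mathbb R^{d+1})$ belongs to the Morrey class $E_q$ if $$\|v\|_{E_q}:=\sup_{\rho>0,\,(t,x)\in\mathbb R^{d+1}}\rho\Bigl(\frac1{|C_\rho(t,x)|}\int_{C_\rho(t,x)}|v(s,y)|^q\,ds\,dy\Bigr)^{1/q}<\infty .$$ For $\gamma>0$ let $$p_\gamma(t,x)=\mathbf 1_{\{t>0\}}\begin{cases} t^{\gamma/2}|x|^{-d-\alpha}, & |x|\ge t^{1/\alpha},\\ t^{\frac\gamma2-\frac{d+\alpha}{\alpha}}, & |x|<t^{1/\alpha},\end{cases}$$ and, for $f\in C_c(\mathbb R^{d+1})$, let $$P_\gamma f(t,x)=\int_{\mathbb R^{d+1}}p_\gamma(s,y)f(t+s,x+y)\,dy\,ds,\qquad P^*_\gamma f(t,x)=\int_{\mathbb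 R^{d+1}}p_\gamma(s,y)f(t-s,x+y)\,dy\,ds .$$ Then there is a constant $C>0$ depending only on $d,p,q,\alpha$ such that for every vector field $b:\mathbb R^{d+1}\to\mathbb R^d$ with $|b|^{\frac1{\alpha-1}}\in E_q$ and every real-valued $f\in C_c(\mathbb R^{d+1})$, with $\gamma=(1-\frac1\alpha)\frac2p$, the functions $|b|\,|P_\gamma f|^p$ and $|b|\,|P^*_\gamma f|^p$ are integrable on $\mathbb R^{d+1}$ and $$\int_{\mathbb R^{d+1}}|b|\,|P_\gamma f|^p\,dz\le C^p\,\bigl\||b|^{\frac1{\alpha-1}}\bigr\|_{E_q}^{\alpha-1}\|f\|_{L^p(\mathbb R^{d+1})}^p,\qquad \int_{\mathbb R^{d+1}}|b|\,|P^*_\gamma f|^p\,dz\le C^p\,\bigl\||b|^{\frac1{\alpha-1}}\bigr\|_{E_q}^{\alpha-1}\|f\|_{L^p(\mathbb R^{d+1})}^p .$$ -/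

import Mathlib

open MeasureTheory
open scoped ENNReal

namespace AdamsKrylov

noncomputable section

/-- Space-time `ℝ^{d+1}`: points `(t, x)` with `x` in Euclidean `ℝ^d`; `volume` is Lebesgue measure. -/
abbrev SpaceTime (d : ℕ) : Type := ℝ × EuclideanSpace ℝ (Fin d)

/-- The parabolic cylinder `C_ρ(t,x) = {(s,y) | t ≤ s ≤ t + ρ^α, |y - x| ≤ ρ}`. -/
def cylinder (d : ℕ) (α ρ : ℝ) (z : SpaceTime d) : Set (SpaceTime d) :=
  {w | z.1 ≤ w.1 ∧ w.1 ≤ z.1 + ρ ^ α ∧ ‖w.2 - z.2‖ ≤ ρ}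

/-- The Morrey norm `‖v‖_{E_q}`, the supremum over `ρ > 0` and `z` of
`ρ (|C_ρ(z)|⁻¹ ∫_{C_ρ(z)} |v|^q)^{1/q}`, with values in `[0, ∞]`. -/
def morreyNorm (d : ℕ) (α q : ℝ) (v : SpaceTime d → ℝ) : ℝ≥0∞ :=
  ⨆ (ρ : ℝ) (_ : 0 < ρ) (z : SpaceTime d),
    ENNReal.ofReal ρ *
      ((volume (cylinder d α ρ z))⁻¹ * ∫⁻ w in cylinder d α ρ z, ‖v w‖ₑ ^ q) ^ (1 / q)

/-- The Morrey class `E_q`: functions in `L^q_loc` with finite Morrey norm. -/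
structure MemMorrey (d : ℕ) (α q : ℝ) (v : SpaceTime d → ℝ) : Prop where
  aestronglyMeasurable : AEStronglyMeasurable v volume
  locallyIntegrable : LocallyIntegrable (fun z => |v z| ^ q) volume
  norm_lt_top : morreyNorm d α q v < ∞

/-- The model kernel `p_γ(t,x)`. -/
def kernel (d : ℕ) (α γ : ℝ) (z : SpaceTime d) : ℝ :=
  if 0 < z.1 then
    if z.1 ^ (1 / α) ≤ ‖z.2‖ then z.1 ^ (γ / 2) * ‖z.2‖ ^ (-(d : ℝ) - α)
    else z.1 ^ (γ / 2 - ((d : ℝ) + α) / α)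
  else 0

/-- `P_γ f(t,x) = ∫ p_γ(s,y) f(t+s, x+y) dy ds`. -/
def P (d : ℕ) (α γ : ℝ) (f : SpaceTime d → ℝ) (z : SpaceTime d) : ℝ :=
  ∫ w : SpaceTime d, kernel d α γ w * f (z.1 + w.1, z.2 + w.2)

/-- `P_γ^* f(t,x) = ∫ p_γ(s,y) f(t-s, x+y) dy ds`. -/
def PStar (d : ℕ) (α γ : ℝ) (f : SpaceTime d → ℝ) (z : SpaceTime d) : ℝ :=
  ∫ w : SpaceTime d, kernel d α γ w * f (z.1 - w.1, z.2 + w.2)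

end

end AdamsKrylov

/-! On an Ahlfors-regular space of dimension `Q`, let `V` be a weight whose `r`-th power, `r > 1`,
has mass at most `H t ^ (Q - β p r)` in balls of radius `t`. A small power of the maximal function
of such a measure is integrated by the Riesz kernel of order `β` into a multiple of a power of
itself, so it serves as a test function for Schur's criterion. This gives the Fefferman–Phong trace
inequality `∫ V (I_β g) ^ p ≤ C H ^ (1 / r) ∫ g ^ p`.

Space-time with the parabolic metric `max (|t| ^ (1 / α)) |x|` is Ahlfors regular of dimension
`d + α`, and there `p_γ` is at most the Riesz kernel of order `β = (α - 1) / p`. The Morrey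
condition on `|b| ^ (1 / (α - 1))` is the growth condition for `V = |b|` and `r = q / (α - 1)`,
since `β p r = q`. -/

namespace AdamsKrylov

open Set Metric Filter Topology

section PowerIntegrals

lemma lintegral_Ioc_rpow_sub_one {a R : ℝ} (ha : 0 < a) (hR : 0 ≤ R) :
    ∫⁻ t in Ioc 0 R, ENNReal.ofReal (t ^ (a - 1)) = ENNReal.ofReal (R ^ a / a) := by
  have hint : IntervalIntegrable (fun t : ℝ => t ^ (a - 1)) volume 0 R :=
    intervalIntegral.intervalIntegrable_rpow' (by linarith)
  rw [← ofReal_integral_eq_lintegral_ofReal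
      ((intervalIntegrable_iff_integrableOn_Ioc_of_le hR).1 hint)
      ((ae_restrict_mem measurableSet_Ioc).mono fun t ht => Real.rpow_nonneg ht.1.le _),
    ← intervalIntegral.integral_of_le hR, integral_rpow (Or.inl (by linarith)),
    sub_add_cancel, Real.zero_rpow ha.ne', sub_zero]

lemma lintegral_Ioi_rpow_sub_one {a R : ℝ} (ha : a < 0) (hR : 0 < R) :
    ∫⁻ t in Ioi R, ENNReal.ofReal (t ^ (a - 1)) = ENNReal.ofReal (R ^ a / -a) := by
  rw [← ofReal_integral_eq_lintegral_ofReal (integrableOn_Ioi_rpow_of_lt (by linarith) hR)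
      ((ae_restrict_mem measurableSet_Ioi).mono fun t ht => Real.rpow_nonneg (hR.trans ht).le _),
    integral_Ioi_rpow_of_lt (by linarith) hR, sub_add_cancel, neg_div, div_neg]

lemma lintegral_rpow_mul_min_le_add {a b R : ℝ} (ha : 0 < a) (hab : a < b) (hR : 0 < R)
    (A D : ℝ≥0∞) :
    ∫⁻ t in Ioi (0 : ℝ), ENNReal.ofReal (t ^ (a - 1)) * min A (D * ENNReal.ofReal (t ^ (-b))) ≤
      ENNReal.ofReal (R ^ a / a) * A + ENNReal.ofReal (R ^ (a - b) / (b - a)) * D := by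
  rw [← Ioc_union_Ioi_eq_Ioi hR.le, lintegral_union measurableSet_Ioi (Ioc_disjoint_Ioi le_rfl)]
  gcongr
  · rw [← lintegral_Ioc_rpow_sub_one ha hR.le, ← lintegral_mul_const _ (by fun_prop)]
    gcongr
    exact min_le_left _ _
  · rw [← neg_sub a b, ← lintegral_Ioi_rpow_sub_one (sub_neg.2 hab) hR,
      ← lintegral_mul_const _ (by fun_prop)]
    refine setLIntegral_mono' measurableSet_Ioi fun t ht => ?_
    have ht : 0 < t := hR.trans ht
    calc ENNReal.ofReal (t ^ (a - 1)) * min A (D * ENNReal.ofReal (t ^ (-b)))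
        ≤ ENNReal.ofReal (t ^ (a - 1)) * (D * ENNReal.ofReal (t ^ (-b))) := by
          gcongr
          exact min_le_right _ _
      _ = ENNReal.ofReal (t ^ (a - 1)) * ENNReal.ofReal (t ^ (-b)) * D := by ring
      _ = ENNReal.ofReal (t ^ (a - b - 1)) * D := by
          rw [← ENNReal.ofReal_mul (by positivity), ← Real.rpow_add ht]
          ring_nf

lemma rpow_mul_eq_of_rpow_eq_div {a b A D R : ℝ} (hb : b ≠ 0) (hA : 0 < A) (hD : 0 < D)
    (hR : 0 < R) (h : R ^ b = D / A) : R ^ a * A = A ^ (1 - a / b) * D ^ (a / b) := by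
  have hRa : R ^ a = (D / A) ^ (a / b) := by
    rw [← h, ← Real.rpow_mul hR.le, mul_div_cancel₀ _ hb]
  rw [hRa, Real.div_rpow hD.le hA.le, Real.rpow_sub hA, Real.rpow_one]
  ring

lemma lintegral_rpow_mul_min_le {a b : ℝ} (ha : 0 < a) (hab : a < b) (A D : ℝ≥0∞) :
    ∫⁻ t in Ioi (0 : ℝ), ENNReal.ofReal (t ^ (a - 1)) * min A (D * ENNReal.ofReal (t ^ (-b))) ≤
      ENNReal.ofReal (1 / a + 1 / (b - a)) * (A ^ (1 - a / b) * D ^ (a / b)) := by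
  have hb : 0 < b := ha.trans hab
  have : 0 < b - a := sub_pos.2 hab
  have hab' : 0 < 1 - a / b := by rwa [sub_pos, div_lt_one hb]
  rcases eq_or_ne A 0 with rfl | hA0
  · simp
  rcases eq_or_ne D 0 with rfl | hD0
  · simp
  by_cases htop : A = ∞ ∨ D = ∞
  · have : A ^ (1 - a / b) * D ^ (a / b) = ∞ := by
      have hab0 : 0 < a / b := by positivity
      rw [ENNReal.mul_eq_top]
      rcases htop with rfl | rfl
      · simp [ENNReal.rpow_eq_zero_iff, hab', hab0.le, hD0]
      · simp only [ENNReal.top_rpow_of_pos hab0, and_true]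
        simp [ENNReal.rpow_eq_zero_iff, hA0, hab'.not_gt]
    rw [this, ENNReal.mul_top (by simp only [ne_eq, ENNReal.ofReal_eq_zero, not_le]; positivity)]
    exact le_top
  push Not at htop
  lift A to NNReal using htop.1
  lift D to NNReal using htop.2
  have hA : 0 < (A : ℝ) := by simpa [pos_iff_ne_zero] using hA0
  have hD : 0 < (D : ℝ) := by simpa [pos_iff_ne_zero] using hD0
  -- Split at the scale `R` where the two terms of the minimum balance.
  obtain ⟨R, hR, hRb⟩ : ∃ R : ℝ, 0 < R ∧ R ^ b = D / A :=
    ⟨(D / A : ℝ) ^ b⁻¹, by positivity, Real.rpow_inv_rpow (by positivity) hb.ne'⟩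
  have hRA : R ^ a * A = (A : ℝ) ^ (1 - a / b) * (D : ℝ) ^ (a / b) :=
    rpow_mul_eq_of_rpow_eq_div hb.ne' hA hD hR hRb
  have hRD : R ^ (a - b) * D = (A : ℝ) ^ (1 - a / b) * (D : ℝ) ^ (a / b) := by
    rw [← hRA, Real.rpow_sub hR, hRb]
    field_simp
  refine (lintegral_rpow_mul_min_le_add ha hab hR A D).trans_eq ?_
  simp only [← ENNReal.ofReal_coe_nnreal, ENNReal.ofReal_rpow_of_pos, hA, hD]
  rw [← ENNReal.ofReal_mul (by positivity), ← ENNReal.ofReal_mul (by positivity),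
    ← ENNReal.ofReal_mul (by positivity), ← ENNReal.ofReal_mul (by positivity),
    ← ENNReal.ofReal_add (by positivity) (by positivity),
    div_mul_eq_mul_div, div_mul_eq_mul_div, hRA, hRD]
  ring_nf

end PowerIntegrals

section WeakType

variable {Y : Type*} [MeasurableSpace Y] {μ : Measure Y} {F : Y → ℝ≥0∞} {D : ℝ≥0∞}

lemma ae_ne_top_of_meas_lt_le_div (hD : D ≠ ∞) (h : ∀ a ≠ 0, μ {x | a < F x} ≤ D / a) :
    ∀ᵐ x ∂μ, F x ≠ ∞ := by
  have hle (n : ℕ) : μ {x | F x = ∞} ≤ D / (n + 1 : ℕ) := by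
    refine le_trans (measure_mono fun x (hx : F x = ∞) => ?_) (h (n + 1 : ℕ) (by simp))
    rw [mem_ofPred_eq, hx]
    exact ENNReal.natCast_lt_top _
  have hlim : Tendsto (fun n : ℕ => D / (n + 1 : ℕ)) atTop (𝓝 0) := by
    simpa [div_eq_mul_inv] using ENNReal.Tendsto.const_mul
      (ENNReal.tendsto_inv_nat_nhds_zero.comp (tendsto_add_atTop_nat 1)) (Or.inr hD)
  simpa [ae_iff] using ge_of_tendsto' hlim hle

/-- Kolmogorov's inequality: weak `L¹` embeds into `L^θ` of a set of finite measure. -/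
lemma setLIntegral_rpow_le_of_meas_lt_le_div (hF : AEMeasurable F μ) (hD : D ≠ ∞)
    (h : ∀ a ≠ 0, μ {x | a < F x} ≤ D / a) {θ : ℝ} (hθ0 : 0 < θ) (hθ1 : θ < 1) (B : Set Y) :
    ∫⁻ x in B, F x ^ θ ∂μ ≤ ENNReal.ofReal (1 / (1 - θ)) * (μ B ^ (1 - θ) * D ^ θ) := by
  have hreal : ∫⁻ x in B, F x ^ θ ∂μ = ∫⁻ x in B, ENNReal.ofReal ((F x).toReal ^ θ) ∂μ := by
    refine lintegral_congr_ae (ae_restrict_of_ae ?_)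
    filter_upwards [ae_ne_top_of_meas_lt_le_div hD h] with x hx
    rw [← ENNReal.ofReal_rpow_of_nonneg ENNReal.toReal_nonneg hθ0.le, ENNReal.ofReal_toReal hx]
  have hmeas {t : ℝ} (ht : 0 < t) :
      μ.restrict B {x | t < (F x).toReal} ≤ min (μ B) (D * ENNReal.ofReal (t ^ (-1 : ℝ))) := by
    refine le_min ((measure_mono (subset_univ _)).trans_eq (by simp)) ?_
    rw [Real.rpow_neg_one, ENNReal.ofReal_inv_of_pos ht, ← div_eq_mul_inv]
    refine (Measure.restrict_apply_le _ _).trans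
      ((measure_mono fun x hx => ?_).trans (h (ENNReal.ofReal t) (by simpa using ht)))
    rw [mem_ofPred_eq, ENNReal.ofReal_lt_iff_lt_toReal ht.le]
    · exact hx
    · intro htop
      simp only [mem_ofPred_eq, htop, ENNReal.toReal_top] at hx
      exact ht.not_gt hx
  rw [hreal, lintegral_rpow_eq_lintegral_meas_lt_mul _
    (ae_of_all _ fun _ => ENNReal.toReal_nonneg) hF.ennreal_toReal.restrict hθ0]
  calc ENNReal.ofReal θ * ∫⁻ t in Ioi 0,
        μ.restrict B {x | t < (F x).toReal} * ENNReal.ofReal (t ^ (θ - 1))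
      ≤ ENNReal.ofReal θ * ∫⁻ t in Ioi 0, ENNReal.ofReal (t ^ (θ - 1)) *
          min (μ B) (D * ENNReal.ofReal (t ^ (-1 : ℝ))) := by
        gcongr ENNReal.ofReal θ * ?_
        refine setLIntegral_mono' measurableSet_Ioi fun t ht => ?_
        rw [mul_comm]
        gcongr
        exact hmeas ht
    _ ≤ ENNReal.ofReal θ * (ENNReal.ofReal (1 / θ + 1 / (1 - θ)) * (μ B ^ (1 - θ) * D ^ θ)) := by
        gcongr
        simpa only [div_one] using lintegral_rpow_mul_min_le hθ0 hθ1 (μ B) D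
    _ = ENNReal.ofReal (1 / (1 - θ)) * (μ B ^ (1 - θ) * D ^ θ) := by
        rw [← mul_assoc, ← ENNReal.ofReal_mul hθ0.le]
        have : 1 - θ ≠ 0 := by linarith
        congr 2
        field_simp
        ring

end WeakType

section Schur

variable {X Y : Type*} [MeasurableSpace X] [MeasurableSpace Y] {μ : Measure X} {ν : Measure Y}

lemma lintegral_rpow_le_lintegral_rpow_mul_lintegral {p : ℝ} (hp : 1 < p) {f ψ : Y → ℝ≥0∞}
    (hf : AEMeasurable f ν) (hψ : AEMeasurable ψ ν) (hψ0 : ∀ᵐ y ∂ν, ψ y ≠ 0)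
    (hψtop : ∀ᵐ y ∂ν, ψ y ≠ ∞) :
    (∫⁻ y, f y ∂ν) ^ p ≤ (∫⁻ y, ψ y ∂ν) ^ (p - 1) * ∫⁻ y, f y ^ p * ψ y ^ (1 - p) ∂ν := by
  have hp0 : 0 < p := by linarith
  have hfact : ∫⁻ y, f y ∂ν =
      ∫⁻ y, ψ y ^ ((p - 1) / p) * (f y ^ p * ψ y ^ (1 - p)) ^ (1 / p) ∂ν := by
    refine lintegral_congr_ae ?_
    filter_upwards [hψ0, hψtop] with y hy0 hytop
    rw [ENNReal.mul_rpow_of_nonneg _ _ (by positivity), ← ENNReal.rpow_mul, ← ENNReal.rpow_mul,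
      mul_one_div_cancel hp0.ne', ENNReal.rpow_one, mul_left_comm, ← ENNReal.rpow_add _ _ hy0 hytop]
    ring_nf
    simp
  calc (∫⁻ y, f y ∂ν) ^ p
      ≤ ((∫⁻ y, ψ y ∂ν) ^ ((p - 1) / p) *
          (∫⁻ y, f y ^ p * ψ y ^ (1 - p) ∂ν) ^ (1 / p)) ^ p := by
        rw [hfact]
        gcongr
        exact ENNReal.lintegral_mul_norm_pow_le hψ (by fun_prop)
          (div_nonneg (by linarith) hp0.le) (by positivity) (by field_simp; ring)
    _ = (∫⁻ y, ψ y ∂ν) ^ (p - 1) * ∫⁻ y, f y ^ p * ψ y ^ (1 - p) ∂ν := by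
        rw [ENNReal.mul_rpow_of_nonneg _ _ hp0.le, ← ENNReal.rpow_mul, ← ENNReal.rpow_mul,
          div_mul_cancel₀ _ hp0.ne', one_div_mul_cancel hp0.ne', ENNReal.rpow_one]

lemma rpow_lintegral_kernel_mul_le {p : ℝ} (hp : 1 < p) {k f ψ : Y → ℝ≥0∞} (hk : Measurable k)
    (hf : AEMeasurable f ν) (hψ : AEMeasurable ψ ν) (hψ0 : ∀ᵐ y ∂ν, ψ y ≠ 0)
    (hψtop : ∀ᵐ y ∂ν, ψ y ≠ ∞) :
    (∫⁻ y, k y * f y ∂ν) ^ p ≤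
      (∫⁻ y, k y * ψ y ∂ν) ^ (p - 1) * ∫⁻ y, k y * (f y ^ p * ψ y ^ (1 - p)) ∂ν := by
  have hac : ν.withDensity k ≪ ν := withDensity_absolutelyContinuous ν k
  have := lintegral_rpow_le_lintegral_rpow_mul_lintegral hp (hf.mono_ac hac) (hψ.mono_ac hac)
    (hac.ae_le hψ0) (hac.ae_le hψtop)
  rwa [lintegral_withDensity_eq_lintegral_mul₀ hk.aemeasurable hf,
    lintegral_withDensity_eq_lintegral_mul₀ hk.aemeasurable hψ,
    lintegral_withDensity_eq_lintegral_mul₀ hk.aemeasurable (by fun_prop)] at this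

/-- Schur's test with weight `w`: it suffices to find one positive supersolution `ψ`. -/
lemma lintegral_mul_rpow_lintegral_le_of_schur [SFinite μ] [SFinite ν] {k : X → Y → ℝ≥0∞}
    (hk : Measurable (Function.uncurry k)) {p : ℝ} (hp : 1 < p) {w : X → ℝ≥0∞} {ψ f : Y → ℝ≥0∞}
    (hw : Measurable w) (hψ : Measurable ψ) (hf : AEMeasurable f ν)
    (hψ0 : ∀ᵐ y ∂ν, ψ y ≠ 0) (hψtop : ∀ᵐ y ∂ν, ψ y ≠ ∞) {C : ℝ≥0∞}
    (h : ∀ y, ∫⁻ x, k x y * (w x * (∫⁻ z, k x z * ψ z ∂ν) ^ (p - 1)) ∂μ ≤ C * ψ y ^ (p - 1)) :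
    ∫⁻ x, w x * (∫⁻ y, k x y * f y ∂ν) ^ p ∂μ ≤ C * ∫⁻ y, f y ^ p ∂ν := by
  have hkx (x : X) : Measurable (k x) := hk.comp measurable_prodMk_left
  have hky (y : Y) : Measurable fun x => k x y := hk.comp measurable_prodMk_right
  set Kψ : X → ℝ≥0∞ := fun x => ∫⁻ z, k x z * ψ z ∂ν
  have hKψ : Measurable Kψ :=
    Measurable.lintegral_prod_right' (f := fun z : X × Y => k z.1 z.2 * ψ z.2)
      (hk.mul (hψ.comp measurable_snd))
  set g : Y → ℝ≥0∞ := fun y => f y ^ p * ψ y ^ (1 - p) with hg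
  have hgm : AEMeasurable g ν := by fun_prop
  calc ∫⁻ x, w x * (∫⁻ y, k x y * f y ∂ν) ^ p ∂μ
      ≤ ∫⁻ x, w x * (Kψ x ^ (p - 1) * ∫⁻ y, k x y * g y ∂ν) ∂μ := by
        gcongr with x
        exact rpow_lintegral_kernel_mul_le hp (hkx x) hf hψ.aemeasurable hψ0 hψtop
    _ = ∫⁻ x, ∫⁻ y, g y * (k x y * (w x * Kψ x ^ (p - 1))) ∂ν ∂μ := by
        refine lintegral_congr fun x => ?_
        rw [← mul_assoc, ← lintegral_const_mul'' (f := fun y => k x y * g y) _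
          ((hkx x).aemeasurable.mul hgm)]
        exact lintegral_congr fun y => by ring
    _ = ∫⁻ y, ∫⁻ x, g y * (k x y * (w x * Kψ x ^ (p - 1))) ∂μ ∂ν :=
        lintegral_lintegral_swap (hgm.comp_snd.mul (hk.mul
          ((hw.mul (hKψ.pow_const _)).comp measurable_fst)).aemeasurable)
    _ = ∫⁻ y, g y * ∫⁻ x, k x y * (w x * Kψ x ^ (p - 1)) ∂μ ∂ν :=
        lintegral_congr fun y =>
          lintegral_const_mul _ ((hky y).mul (hw.mul (hKψ.pow_const _)))
    _ ≤ ∫⁻ y, g y * (C * ψ y ^ (p - 1)) ∂ν := by gcongr with y; exact h y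
    _ = ∫⁻ y, C * f y ^ p ∂ν := by
        refine lintegral_congr_ae ?_
        filter_upwards [hψ0, hψtop] with y hy0 hytop
        have hcancel : ψ y ^ (1 - p) * ψ y ^ (p - 1) = 1 := by
          rw [← ENNReal.rpow_add _ _ hy0 hytop, sub_add_sub_cancel, sub_self, ENNReal.rpow_zero]
        calc g y * (C * ψ y ^ (p - 1)) = C * f y ^ p * (ψ y ^ (1 - p) * ψ y ^ (p - 1)) := by
              simp only [hg]
              ring
          _ = C * f y ^ p := by rw [hcancel, mul_one]
    _ = C * ∫⁻ y, f y ^ p ∂ν := lintegral_const_mul'' _ (hf.pow_const _)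

end Schur

section ScalePowers

variable {r s : ℝ}

lemma ofReal_rpow_ne_zero (hr : 0 < r) (s : ℝ) : ENNReal.ofReal r ^ s ≠ 0 := by
  simp [ENNReal.rpow_eq_zero_iff, hr]

lemma ofReal_rpow_ne_top (hr : 0 < r) (s : ℝ) : ENNReal.ofReal r ^ s ≠ ∞ := by
  simp [ENNReal.rpow_eq_top_iff, hr]

lemma ofReal_mul_rpow {a : ℝ} (ha : 0 ≤ a) (hs : 0 ≤ s) (r : ℝ) :
    ENNReal.ofReal (a * r) ^ s = ENNReal.ofReal a ^ s * ENNReal.ofReal r ^ s := by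
  rw [ENNReal.ofReal_mul ha, ENNReal.mul_rpow_of_nonneg _ _ hs]

lemma ofReal_rpow_sub_le {t l : ℝ} (hr : 0 < r) (ht : r ≤ t) (hl : 0 ≤ l) (s : ℝ) :
    ENNReal.ofReal t ^ (s - l) ≤ ENNReal.ofReal r ^ (-l) * ENNReal.ofReal t ^ s := by
  rw [sub_eq_neg_add, ENNReal.rpow_add _ _ (by simpa using hr.trans_le ht) ENNReal.ofReal_ne_top,
    ENNReal.rpow_neg, ENNReal.rpow_neg]
  gcongr

end ScalePowers

section BallGrowth

variable {X : Type*} [PseudoMetricSpace X] [MeasurableSpace X]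

/-- The growth condition `ν (B(x, r)) ≤ C r ^ s` at all scales. It serves both as the upper half of
Ahlfors regularity and as the Morrey condition on a density. -/
def HasBallGrowth (ν : Measure X) (s : ℝ) (C : ℝ≥0∞) : Prop :=
  ∀ (x : X) (r : ℝ), 0 < r → ν (ball x r) ≤ C * ENNReal.ofReal r ^ s

/-- Ahlfors `Q`-regularity of a measure at all scales, with lower constant `c` and upper
constant `C`. -/
structure IsAhlforsRegular (μ : Measure X) (Q : ℝ) (c C : ℝ≥0∞) : Prop where
  le_measure_ball (x : X) (r : ℝ) : 0 < r → c * ENNReal.ofReal r ^ Q ≤ μ (ball x r)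
  hasBallGrowth : HasBallGrowth μ Q C

lemma isLocallyFiniteMeasure_of_measure_ball_ne_top {ν : Measure X}
    (h : ∀ x : X, ν (ball x 1) ≠ ∞) : IsLocallyFiniteMeasure ν :=
  ⟨fun x => ⟨ball x 1, ball_mem_nhds x one_pos, (h x).lt_top⟩⟩

variable {μ : Measure X} {s Q : ℝ} {c C : ℝ≥0∞}

lemma HasBallGrowth.measure_ball_ne_top (h : HasBallGrowth μ s C) (hC : C ≠ ∞) (x : X) {r : ℝ}
    (hr : 0 < r) : μ (ball x r) ≠ ∞ :=
  ne_top_of_le_ne_top (ENNReal.mul_ne_top hC (ofReal_rpow_ne_top hr s)) (h x r hr)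

lemma HasBallGrowth.isLocallyFiniteMeasure (h : HasBallGrowth μ s C) (hC : C ≠ ∞) :
    IsLocallyFiniteMeasure μ :=
  isLocallyFiniteMeasure_of_measure_ball_ne_top fun x => h.measure_ball_ne_top hC x one_pos

lemma HasBallGrowth.measure_ball_le_of_le {l : ℝ} (h : HasBallGrowth μ (Q - l) C) (hl : 0 ≤ l)
    (x : X) {r t : ℝ} (hr : 0 < r) (hrt : r ≤ t) :
    μ (ball x t) ≤ C * ENNReal.ofReal r ^ (-l) * ENNReal.ofReal t ^ Q := by
  rw [mul_assoc]
  exact (h x t (hr.trans_le hrt)).trans (by gcongr; exact ofReal_rpow_sub_le hr hrt hl Q)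

lemma IsAhlforsRegular.isUnifLocDoublingMeasure (h : IsAhlforsRegular μ Q c C) (hQ : 0 < Q)
    (hc : c ≠ 0) (hC : C ≠ ∞) : IsUnifLocDoublingMeasure μ := by
  rcases isEmpty_or_nonempty X with _ | ⟨⟨x₀⟩⟩
  · exact ⟨0, Eventually.of_forall fun _ x => isEmptyElim x⟩
  have hctop : c ≠ ∞ := by
    rintro rfl
    have := h.le_measure_ball x₀ 1 one_pos
    simp only [ENNReal.ofReal_one, ENNReal.one_rpow, mul_one, top_le_iff] at this
    exact h.hasBallGrowth.measure_ball_ne_top hC x₀ one_pos this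
  set K : ℝ≥0∞ := C / c * ENNReal.ofReal 4 ^ Q with hK
  have hKtop : K ≠ ∞ :=
    ENNReal.mul_ne_top (ENNReal.div_ne_top hC hc) (ofReal_rpow_ne_top (by norm_num) Q)
  refine ⟨K.toNNReal, eventually_nhdsWithin_of_forall fun r hr x => ?_⟩
  have hr : 0 < r := hr
  rw [ENNReal.coe_toNNReal hKtop]
  calc μ (closedBall x (2 * r)) ≤ μ (ball x (4 * r)) :=
        measure_mono (closedBall_subset_ball (by linarith))
    _ ≤ C * ENNReal.ofReal (4 * r) ^ Q := h.hasBallGrowth x _ (by linarith)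
    _ = K * (c * ENNReal.ofReal r ^ Q) := by
        rw [ofReal_mul_rpow (by norm_num) hQ.le, hK, mul_assoc, ← mul_assoc (C / c),
          mul_right_comm, ← mul_assoc, ← mul_assoc, ENNReal.div_mul_cancel hc hctop]
        ring
    _ ≤ K * μ (closedBall x r) := by
        gcongr
        exact (h.le_measure_ball x r hr).trans (measure_mono ball_subset_closedBall)

end BallGrowth

section MaximalFunction

variable {X : Type*} [PseudoMetricSpace X] [MeasurableSpace X] {Q : ℝ} {ν : Measure X} {a : ℝ≥0∞}

/-- The uncentred maximal function of a measure, normalised by `r ^ Q` in place of the measure of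
the ball, so that it is defined without a reference measure. -/
noncomputable def maximalFunction (Q : ℝ) (ν : Measure X) (x : X) : ℝ≥0∞ :=
  ⨆ (y : X) (r : ℝ) (_ : 0 < r) (_ : x ∈ ball y r), ν (ball y r) / ENNReal.ofReal r ^ Q

lemma maximalFunction_le_iff {x : X} :
    maximalFunction Q ν x ≤ a ↔
      ∀ y r, 0 < r → x ∈ ball y r → ν (ball y r) / ENNReal.ofReal r ^ Q ≤ a := by
  simp only [maximalFunction, iSup_le_iff]

lemma lt_maximalFunction_iff {x : X} :
    a < maximalFunction Q ν x ↔
      ∃ y r, 0 < r ∧ x ∈ ball y r ∧ a < ν (ball y r) / ENNReal.ofReal r ^ Q := by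
  simp only [maximalFunction, lt_iSup_iff, exists_prop]

lemma le_maximalFunction {x y : X} {r : ℝ} (hr : 0 < r) (hx : x ∈ ball y r) :
    ν (ball y r) / ENNReal.ofReal r ^ Q ≤ maximalFunction Q ν x :=
  maximalFunction_le_iff.1 le_rfl y r hr hx

lemma measure_ball_le_maximalFunction_mul (Q : ℝ) (ν : Measure X) (x : X) {r : ℝ} (hr : 0 < r) :
    ν (ball x r) ≤ maximalFunction Q ν x * ENNReal.ofReal r ^ Q := by
  rw [← ENNReal.div_le_iff (ofReal_rpow_ne_zero hr Q) (ofReal_rpow_ne_top hr Q)]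
  exact le_maximalFunction hr (mem_ball_self hr)

lemma maximalFunction_ne_zero (hν : ν ≠ 0) (x : X) : maximalFunction Q ν x ≠ 0 := by
  intro h
  refine hν (Measure.measure_univ_eq_zero.1 ?_)
  rw [← iUnion_ball_nat_succ x, measure_iUnion_null_iff]
  intro n
  simpa [h] using measure_ball_le_maximalFunction_mul Q ν x (r := (n : ℝ) + 1) (by positivity)

lemma isOpen_lt_maximalFunction (Q : ℝ) (ν : Measure X) (a : ℝ≥0∞) :
    IsOpen {x | a < maximalFunction Q ν x} := by
  have : {x | a < maximalFunction Q ν x} =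
      ⋃ (y : X) (r : ℝ) (_ : 0 < r) (_ : a < ν (ball y r) / ENNReal.ofReal r ^ Q), ball y r := by
    ext x
    simp only [mem_ofPred_eq, lt_maximalFunction_iff, mem_iUnion, exists_prop]
    tauto
  rw [this]
  exact isOpen_iUnion fun y => isOpen_iUnion fun r => isOpen_iUnion fun _ => isOpen_iUnion fun _ =>
    isOpen_ball

/-- Balls of radius at most `r` meeting `B(x, r)` lie in `B(x, 3r)`; larger ones are controlled by
the growth of `ν` around `x`. -/
lemma maximalFunction_le_max_restrict (hQ : 0 ≤ Q) {x w : X} {r : ℝ} {N : ℝ≥0∞}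
    (hN : ∀ t, r ≤ t → ν (ball x t) ≤ N * ENNReal.ofReal t ^ Q) (hw : w ∈ ball x r) :
    maximalFunction Q ν w ≤
      max (maximalFunction Q (ν.restrict (ball x (3 * r))) w) (ENNReal.ofReal 3 ^ Q * N) := by
  refine maximalFunction_le_iff.2 fun y t ht hwy => ?_
  rw [mem_ball] at hw
  have hwy' : dist w y < t := hwy
  rcases le_total t r with htr | htr
  · have hsub : ball y t ⊆ ball x (3 * r) :=
      ball_subset_ball' (by linarith [dist_triangle y w x, dist_comm y w])
    rw [← Measure.restrict_eq_self ν hsub]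
    exact le_max_of_le_left (le_maximalFunction ht hwy)
  · refine le_max_of_le_right ?_
    rw [ENNReal.div_le_iff (ofReal_rpow_ne_zero ht _) (ofReal_rpow_ne_top ht _)]
    calc ν (ball y t) ≤ ν (ball x (3 * t)) :=
          measure_mono (ball_subset_ball' (by linarith [dist_triangle y w x, dist_comm y w]))
      _ ≤ N * ENNReal.ofReal (3 * t) ^ Q := hN _ (by linarith)
      _ = ENNReal.ofReal 3 ^ Q * N * ENNReal.ofReal t ^ Q := by
          rw [ofReal_mul_rpow (by norm_num) hQ]
          ring

/-- The balls of `ν`-density above `a` have bounded radii, so the Vitali covering lemma applies. -/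
lemma exists_pairwiseDisjoint_ball_covering [SecondCountableTopology X] (hQ : 0 < Q)
    (ν : Measure X) [IsFiniteMeasure ν] (ha : a ≠ 0) (ha' : a ≠ ∞) :
    ∃ u : Set (X × ℝ), u.Countable ∧ u.PairwiseDisjoint (fun i => ball i.1 i.2) ∧
      (∀ i ∈ u, 0 < i.2 ∧ a * ENNReal.ofReal i.2 ^ Q ≤ ν (ball i.1 i.2)) ∧
      {x | a < maximalFunction Q ν x} ⊆ ⋃ i ∈ u, ball i.1 (4 * i.2) := by
  let t : Set (X × ℝ) := {i | 0 < i.2 ∧ a < ν (ball i.1 i.2) / ENNReal.ofReal i.2 ^ Q}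
  have hle (i) (hi : i ∈ t) : a * ENNReal.ofReal i.2 ^ Q ≤ ν (ball i.1 i.2) :=
    ((ENNReal.lt_div_iff_mul_lt (Or.inl (ofReal_rpow_ne_zero hi.1 Q))
      (Or.inl (ofReal_rpow_ne_top hi.1 Q))).1 hi.2).le
  have hradius (i) (hi : i ∈ t) : i.2 ≤ ((ν univ / a) ^ Q⁻¹).toReal := by
    have hpow : ENNReal.ofReal i.2 ^ Q ≤ ν univ / a := by
      rw [ENNReal.le_div_iff_mul_le (Or.inl ha) (Or.inl ha'), mul_comm]
      exact (hle i hi).trans (measure_mono (subset_univ _))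
    exact (ENNReal.ofReal_le_iff_le_toReal (ENNReal.rpow_ne_top_of_nonneg (by positivity)
      (ENNReal.div_ne_top (measure_ne_top _ _) ha))).1 ((ENNReal.le_rpow_inv_iff hQ).2 hpow)
  obtain ⟨u, hut, hdisj, hcov⟩ := Vitali.exists_disjoint_subfamily_covering_enlargement_ball t
    Prod.fst Prod.snd _ hradius 4 (by norm_num)
  refine ⟨u, hdisj.countable_of_isOpen (fun _ _ => isOpen_ball)
    fun i hi => ⟨i.1, mem_ball_self (hut hi).1⟩, hdisj,
    fun i hi => ⟨(hut hi).1, hle i (hut hi)⟩, fun x hx => ?_⟩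
  obtain ⟨y, r, hr, hxy, h⟩ := lt_maximalFunction_iff.1 hx
  obtain ⟨i, hi, hsub⟩ := hcov (y, r) ⟨hr, h⟩
  exact mem_biUnion hi (hsub hxy)

variable [OpensMeasurableSpace X]

@[fun_prop]
lemma measurable_maximalFunction (Q : ℝ) (ν : Measure X) : Measurable (maximalFunction Q ν) :=
  measurable_of_Ioi fun a => (isOpen_lt_maximalFunction Q ν a).measurableSet

variable [SecondCountableTopology X] {μ : Measure X} {c : ℝ≥0∞}

lemma measure_lt_maximalFunction_le (hQ : 0 < Q) (hμ : HasBallGrowth μ Q c) (ν : Measure X)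
    [IsFiniteMeasure ν] (ha : a ≠ 0) :
    μ {x | a < maximalFunction Q ν x} ≤ c * ENNReal.ofReal 4 ^ Q * ν univ / a := by
  rcases eq_or_ne a ∞ with rfl | ha'
  · simp
  obtain ⟨u, hcount, hdisj, hu, hcov⟩ := exists_pairwiseDisjoint_ball_covering hQ ν ha ha'
  have hball (i : X × ℝ) (hi : i ∈ u) :
      μ (ball i.1 (4 * i.2)) ≤ c * ENNReal.ofReal 4 ^ Q / a * ν (ball i.1 i.2) := by
    obtain ⟨hpos, hle⟩ := hu i hi
    calc μ (ball i.1 (4 * i.2)) ≤ c * ENNReal.ofReal (4 * i.2) ^ Q := hμ _ _ (by positivity)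
      _ = c * ENNReal.ofReal 4 ^ Q / a * (a * ENNReal.ofReal i.2 ^ Q) := by
          rw [ofReal_mul_rpow (by norm_num) hQ.le, ← mul_assoc _ a, ENNReal.div_mul_cancel ha ha',
            mul_assoc]
      _ ≤ c * ENNReal.ofReal 4 ^ Q / a * ν (ball i.1 i.2) := by gcongr
  calc μ {x | a < maximalFunction Q ν x} ≤ μ (⋃ i ∈ u, ball i.1 (4 * i.2)) := measure_mono hcov
    _ ≤ ∑' i : u, μ (ball i.1.1 (4 * i.1.2)) := measure_biUnion_le _ hcount _
    _ ≤ ∑' i : u, c * ENNReal.ofReal 4 ^ Q / a * ν (ball i.1.1 i.1.2) :=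
        ENNReal.tsum_le_tsum fun i => hball i i.2
    _ = c * ENNReal.ofReal 4 ^ Q / a * ν (⋃ i ∈ u, ball i.1 i.2) := by
        rw [ENNReal.tsum_mul_left, measure_biUnion hcount hdisj fun _ _ => measurableSet_ball]
    _ ≤ c * ENNReal.ofReal 4 ^ Q / a * ν univ := by gcongr; exact subset_univ _
    _ = c * ENNReal.ofReal 4 ^ Q * ν univ / a := ENNReal.mul_div_right_comm.symm

end MaximalFunction

section BallAverages

variable {X : Type*} [PseudoMetricSpace X] [MeasurableSpace X] [OpensMeasurableSpace X]
  [SecondCountableTopology X] {μ ν : Measure X} {Q : ℝ} {A : ℝ≥0∞}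

lemma HasBallGrowth.ae_maximalFunction_ne_top (hμ : HasBallGrowth μ Q A) (hQ : 0 < Q) (hA : A ≠ ∞)
    {l : ℝ} {H : ℝ≥0∞} (hν : HasBallGrowth ν (Q - l) H) (hl : 0 ≤ l) (hH : H ≠ ∞) :
    ∀ᵐ x ∂μ, maximalFunction Q ν x ≠ ∞ := by
  rcases isEmpty_or_nonempty X with _ | ⟨⟨x₀⟩⟩
  · exact ae_of_all _ fun x => isEmptyElim x
  have hball (n : ℕ) : ∀ᵐ x ∂μ, x ∈ ball x₀ (n + 1) → maximalFunction Q ν x ≠ ∞ := by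
    have hn : (0 : ℝ) < n + 1 := by positivity
    have hfin : ν (ball x₀ (3 * (n + 1))) ≠ ∞ := hν.measure_ball_ne_top hH x₀ (by positivity)
    have : IsFiniteMeasure (ν.restrict (ball x₀ (3 * (n + 1)))) :=
      isFiniteMeasure_restrict.2 hfin
    have hfar : ENNReal.ofReal 3 ^ Q * (H * ENNReal.ofReal (n + 1) ^ (-l)) ≠ ∞ :=
      ENNReal.mul_ne_top (ofReal_rpow_ne_top (by norm_num) Q)
        (ENNReal.mul_ne_top hH (ofReal_rpow_ne_top hn _))
    filter_upwards [ae_ne_top_of_meas_lt_le_div (ENNReal.mul_ne_top (ENNReal.mul_ne_top hA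
        (ofReal_rpow_ne_top (by norm_num) Q)) (measure_ne_top _ _)) fun a ha =>
      measure_lt_maximalFunction_le hQ hμ (ν.restrict (ball x₀ (3 * (n + 1)))) ha] with x hx hxn
    refine ne_top_of_le_ne_top (max_ne_top hx hfar) (maximalFunction_le_max_restrict hQ.le
      (fun t ht => hν.measure_ball_le_of_le hl x₀ hn ht) hxn)
  filter_upwards [ae_all_iff.2 hball] with x hx
  obtain ⟨n, hn⟩ := mem_iUnion.1 ((iUnion_ball_nat_succ x₀).symm ▸ mem_univ x)
  exact hx n hn

lemma HasBallGrowth.setLIntegral_maximalFunction_rpow_le (hμ : HasBallGrowth μ Q A) (hQ : 0 < Q)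
    (hA : A ≠ ∞) (ν : Measure X) [IsFiniteMeasure ν] {θ : ℝ} (hθ0 : 0 < θ) (hθ1 : θ < 1)
    (B : Set X) :
    ∫⁻ w in B, maximalFunction Q ν w ^ θ ∂μ ≤
      ENNReal.ofReal (1 / (1 - θ)) * (μ B ^ (1 - θ) * (A * ENNReal.ofReal 4 ^ Q * ν univ) ^ θ) :=
  setLIntegral_rpow_le_of_meas_lt_le_div (by fun_prop)
    (ENNReal.mul_ne_top (ENNReal.mul_ne_top hA (ofReal_rpow_ne_top (by norm_num) Q))
      (measure_ne_top _ _))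
    (fun _ ha => measure_lt_maximalFunction_le hQ hμ ν ha) hθ0 hθ1 B

lemma HasBallGrowth.exists_setLIntegral_ball_maximalFunction_rpow_le (hμ : HasBallGrowth μ Q A)
    (hQ : 0 < Q) (hA : A ≠ ∞) {θ : ℝ} (hθ0 : 0 < θ) (hθ1 : θ < 1) :
    ∃ C : ℝ≥0∞, C ≠ ∞ ∧ ∀ (ν : Measure X) (x : X) (r : ℝ) (N : ℝ≥0∞), 0 < r → N ≠ ∞ →
      (∀ t, r ≤ t → ν (ball x t) ≤ N * ENNReal.ofReal t ^ Q) →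
      ∫⁻ w in ball x r, maximalFunction Q ν w ^ θ ∂μ ≤ C * (N ^ θ * ENNReal.ofReal r ^ Q) := by
  have h1θ : 0 < 1 - θ := by linarith
  set K : ℝ≥0∞ := ENNReal.ofReal (1 / (1 - θ))
  set L : ℝ≥0∞ := ENNReal.ofReal 3 ^ Q
  have hL : L ≠ ∞ := ofReal_rpow_ne_top (by norm_num) _
  set F : ℝ≥0∞ := ENNReal.ofReal 4 ^ Q
  have hF : F ≠ ∞ := ofReal_rpow_ne_top (by norm_num) _
  refine ⟨K * (A ^ (1 - θ) * (A * F * L) ^ θ) + L ^ θ * A, by finiteness, ?_⟩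
  intro ν x r N hr hN hν
  set R : ℝ≥0∞ := ENNReal.ofReal r ^ Q
  have hR : R ≠ ∞ := ofReal_rpow_ne_top hr _
  set ν' := ν.restrict (ball x (3 * r)) with hν'
  have hν'u : ν' univ ≤ N * (L * R) := by
    rw [hν', Measure.restrict_apply_univ, ← ofReal_mul_rpow (by norm_num) hQ.le]
    exact hν _ (by linarith)
  have : IsFiniteMeasure ν' := ⟨hν'u.trans_lt (by finiteness)⟩
  calc ∫⁻ w in ball x r, maximalFunction Q ν w ^ θ ∂μ
      ≤ ∫⁻ w in ball x r, (maximalFunction Q ν' w ^ θ + (L * N) ^ θ) ∂μ := by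
        refine setLIntegral_mono' measurableSet_ball fun w hw => ?_
        refine (ENNReal.rpow_le_rpow (maximalFunction_le_max_restrict hQ.le hν hw) hθ0.le).trans ?_
        rw [(ENNReal.monotone_rpow_of_nonneg hθ0.le).map_max]
        exact max_le_add_of_nonneg zero_le zero_le
    _ = ∫⁻ w in ball x r, maximalFunction Q ν' w ^ θ ∂μ + (L * N) ^ θ * μ (ball x r) := by
        rw [lintegral_add_right _ measurable_const, setLIntegral_const]
    _ ≤ K * (μ (ball x r) ^ (1 - θ) * (A * F * ν' univ) ^ θ) + (L * N) ^ θ * μ (ball x r) := by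
        gcongr
        exact hμ.setLIntegral_maximalFunction_rpow_le hQ hA ν' hθ0 hθ1 _
    _ ≤ K * ((A * R) ^ (1 - θ) * (A * F * (N * (L * R))) ^ θ) + (L * N) ^ θ * (A * R) := by
        have hball : μ (ball x r) ≤ A * R := hμ x r hr
        gcongr
    _ = K * (A ^ (1 - θ) * (A * F * L) ^ θ) * (N ^ θ * (R ^ (1 - θ) * R ^ θ)) +
          L ^ θ * A * (N ^ θ * R) := by
        simp only [ENNReal.mul_rpow_of_nonneg _ _ h1θ.le, ENNReal.mul_rpow_of_nonneg _ _ hθ0.le]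
        ring
    _ = (K * (A ^ (1 - θ) * (A * F * L) ^ θ) + L ^ θ * A) * (N ^ θ * R) := by
        rw [← ENNReal.rpow_add_of_nonneg _ _ h1θ.le hθ0.le, sub_add_cancel, ENNReal.rpow_one,
          add_mul]

lemma HasBallGrowth.exists_setLIntegral_ball_maximalFunction_rpow_le_min
    (hμ : HasBallGrowth μ Q A) (hQ : 0 < Q) (hA : A ≠ ∞) {l θ : ℝ} (hl : 0 ≤ l) (hθ0 : 0 < θ)
    (hθ1 : θ < 1) :
    ∃ C : ℝ≥0∞, C ≠ ∞ ∧ ∀ (ν : Measure X) (H : ℝ≥0∞), H ≠ ∞ → HasBallGrowth ν (Q - l) H →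
      ∀ (x : X) (t : ℝ), 0 < t → ∫⁻ y in ball x t, maximalFunction Q ν y ^ θ ∂μ ≤
        C * (min (maximalFunction Q ν x ^ θ) (H ^ θ * ENNReal.ofReal (t ^ (-(l * θ)))) *
          ENNReal.ofReal t ^ Q) := by
  obtain ⟨C, hC, haverage⟩ := hμ.exists_setLIntegral_ball_maximalFunction_rpow_le hQ hA hθ0 hθ1
  refine ⟨C, hC, fun ν H hH hν x t ht => ?_⟩
  set m := maximalFunction Q ν x
  have hmin : min m (H * ENNReal.ofReal t ^ (-l)) ^ θ =
      min (m ^ θ) (H ^ θ * ENNReal.ofReal (t ^ (-(l * θ)))) := by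
    rw [(ENNReal.monotone_rpow_of_nonneg hθ0.le).map_min, ENNReal.mul_rpow_of_nonneg _ _ hθ0.le,
      ← ENNReal.rpow_mul, ENNReal.ofReal_rpow_of_pos ht, neg_mul]
  rw [← hmin]
  refine haverage ν x t _ ht (ne_top_of_le_ne_top (ENNReal.mul_ne_top hH
    (ofReal_rpow_ne_top ht _)) (min_le_right _ _)) fun s hs => ?_
  rcases min_choice m (H * ENNReal.ofReal t ^ (-l)) with h | h <;> rw [h]
  · exact measure_ball_le_maximalFunction_mul Q ν x (ht.trans_le hs)
  · exact hν.measure_ball_le_of_le hl x ht hs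

end BallAverages

section RieszPotential

variable {X : Type*} [PseudoMetricSpace X] [MeasurableSpace X] {μ : Measure X} {Q β : ℝ}

/-- The Riesz potential of order `β` in dimension `Q`. For `β < Q` the kernel takes the junk value
`0` on the diagonal, which is harmless when points are `μ`-null. -/
noncomputable def rieszPotential (μ : Measure X) (Q β : ℝ) (g : X → ℝ≥0∞) (x : X) : ℝ≥0∞ :=
  ∫⁻ y, ENNReal.ofReal (dist x y ^ (β - Q)) * g y ∂μ

lemma rieszPotential_mono {g h : X → ℝ≥0∞} (hgh : ∀ y, g y ≤ h y) (x : X) :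
    rieszPotential μ Q β g x ≤ rieszPotential μ Q β h x :=
  lintegral_mono fun y => by gcongr; exact hgh y

lemma ofReal_rpow_le_lintegral_Ioi {a d : ℝ} (ha : a < 0) (hd : 0 ≤ d) :
    ENNReal.ofReal (d ^ a) ≤ ENNReal.ofReal (-a) * ∫⁻ t in Ioi d, ENNReal.ofReal (t ^ (a - 1)) := by
  rcases hd.eq_or_lt with rfl | hd
  · simp [Real.zero_rpow ha.ne]
  · rw [lintegral_Ioi_rpow_sub_one ha hd, ← ENNReal.ofReal_mul (by linarith),
      mul_div_cancel₀ _ (by linarith)]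

variable [OpensMeasurableSpace X]

lemma rieszPotential_const_mul (c : ℝ≥0∞) {g : X → ℝ≥0∞} (hg : Measurable g) (x : X) :
    rieszPotential μ Q β (fun y => c * g y) x = c * rieszPotential μ Q β g x := by
  rw [rieszPotential, rieszPotential, ← lintegral_const_mul _ (by fun_prop)]
  exact lintegral_congr fun y => mul_left_comm _ _ _

variable [SecondCountableTopology X]

lemma lintegral_lintegral_Ioi_dist_mul [SFinite μ] {φ : ℝ → ℝ≥0∞} (hφ : Measurable φ)
    {g : X → ℝ≥0∞} (hg : Measurable g) (x : X) :
    ∫⁻ y, (∫⁻ t in Ioi (dist x y), φ t) * g y ∂μ =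
      ∫⁻ t in Ioi (0 : ℝ), φ t * ∫⁻ y in ball x t, g y ∂μ := by
  have hs : MeasurableSet {z : X × ℝ | dist x z.1 < z.2} :=
    measurableSet_lt (by fun_prop) measurable_snd
  calc ∫⁻ y, (∫⁻ t in Ioi (dist x y), φ t) * g y ∂μ
      = ∫⁻ y, (∫⁻ t in Ioi (0 : ℝ), (Ioi (dist x y)).indicator φ t * g y) ∂μ := by
        refine lintegral_congr fun y => ?_
        rw [lintegral_mul_const _ (hφ.indicator measurableSet_Ioi),
          setLIntegral_indicator measurableSet_Ioi, inter_eq_left.2 (Ioi_subset_Ioi dist_nonneg)]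
    _ = ∫⁻ t in Ioi (0 : ℝ), ∫⁻ y, (Ioi (dist x y)).indicator φ t * g y ∂μ := by
        refine lintegral_lintegral_swap (Measurable.aemeasurable ?_)
        exact ((hφ.comp measurable_snd).indicator hs).mul (hg.comp measurable_fst)
    _ = ∫⁻ t in Ioi (0 : ℝ), φ t * ∫⁻ y in ball x t, g y ∂μ := by
        refine lintegral_congr fun t => ?_
        rw [← lintegral_const_mul _ hg, ← lintegral_indicator measurableSet_ball]
        classical
        refine lintegral_congr fun y => ?_
        simp only [indicator_apply, mem_Ioi, mem_ball', ite_mul, zero_mul]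

lemma rieszPotential_le_lintegral_ball [SFinite μ] (hβ : β < Q) {g : X → ℝ≥0∞} (hg : Measurable g)
    (x : X) :
    rieszPotential μ Q β g x ≤ ENNReal.ofReal (Q - β) *
      ∫⁻ t in Ioi (0 : ℝ), ENNReal.ofReal (t ^ (β - Q - 1)) * ∫⁻ y in ball x t, g y ∂μ := by
  rw [← lintegral_lintegral_Ioi_dist_mul (by fun_prop) hg,
    ← lintegral_const_mul' _ _ ENNReal.ofReal_ne_top]
  refine lintegral_mono fun y => ?_
  rw [← mul_assoc, ← neg_sub β Q]
  gcongr
  exact ofReal_rpow_le_lintegral_Ioi (sub_neg.2 hβ) dist_nonneg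

/-- Fractional powers of the maximal function of a Morrey measure are, up to an explicit power,
supersolutions of the Riesz potential. -/
lemma HasBallGrowth.exists_rieszPotential_maximalFunction_rpow_le [SFinite μ] {A : ℝ≥0∞}
    (hμ : HasBallGrowth μ Q A) (hA : A ≠ ∞) {l θ : ℝ} (hβ : 0 < β) (hβQ : β < Q) (hl : 0 < l)
    (hθ : β / l < θ) (hθ1 : θ < 1) :
    ∃ C : ℝ≥0∞, C ≠ ∞ ∧ ∀ (ν : Measure X) (H : ℝ≥0∞), H ≠ ∞ → HasBallGrowth ν (Q - l) H → ∀ x,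
      rieszPotential μ Q β (fun y => maximalFunction Q ν y ^ θ) x ≤
        C * (H ^ (β / l) * maximalFunction Q ν x ^ (θ - β / l)) := by
  have hθ0 : 0 < θ := (div_pos hβ hl).trans hθ
  have hβθ : β < l * θ := by rwa [div_lt_iff₀' hl] at hθ
  obtain ⟨C, hC, hball⟩ := hμ.exists_setLIntegral_ball_maximalFunction_rpow_le_min
    (hβ.trans hβQ) hA hl.le hθ0 hθ1
  refine ⟨ENNReal.ofReal (Q - β) * (C * ENNReal.ofReal (1 / β + 1 / (l * θ - β))),
    by finiteness, fun ν H hH hν x => ?_⟩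
  set m := maximalFunction Q ν x
  have hexp : (m ^ θ) ^ (1 - β / (l * θ)) * (H ^ θ) ^ (β / (l * θ)) =
      H ^ (β / l) * m ^ (θ - β / l) := by
    rw [← ENNReal.rpow_mul, ← ENNReal.rpow_mul, mul_comm]
    congr 2 <;> field_simp
  refine (rieszPotential_le_lintegral_ball hβQ (by fun_prop) x).trans ?_
  rw [mul_assoc, mul_assoc, ← hexp]
  gcongr
  refine le_trans ?_ (mul_le_mul_right (lintegral_rpow_mul_min_le hβ hβθ (m ^ θ) (H ^ θ)) C)
  rw [← lintegral_const_mul' _ _ hC]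
  refine setLIntegral_mono' measurableSet_Ioi fun t (ht : 0 < t) => ?_
  have hpow : ENNReal.ofReal (t ^ (β - Q - 1)) * ENNReal.ofReal t ^ Q =
      ENNReal.ofReal (t ^ (β - 1)) := by
    rw [ENNReal.ofReal_rpow_of_pos ht, ← ENNReal.ofReal_mul (by positivity), ← Real.rpow_add ht]
    ring_nf
  calc ENNReal.ofReal (t ^ (β - Q - 1)) * ∫⁻ y in ball x t, maximalFunction Q ν y ^ θ ∂μ
      ≤ ENNReal.ofReal (t ^ (β - Q - 1)) *
          (C * (min (m ^ θ) (H ^ θ * ENNReal.ofReal (t ^ (-(l * θ)))) * ENNReal.ofReal t ^ Q)) := by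
        gcongr
        exact hball ν H hH hν x t ht
    _ = C * (ENNReal.ofReal (t ^ (β - Q - 1)) * ENNReal.ofReal t ^ Q *
          min (m ^ θ) (H ^ θ * ENNReal.ofReal (t ^ (-(l * θ))))) := by ring
    _ = C * (ENNReal.ofReal (t ^ (β - 1)) *
          min (m ^ θ) (H ^ θ * ENNReal.ofReal (t ^ (-(l * θ))))) := by rw [hpow]

end RieszPotential

section TraceInequality

variable {X : Type*} [PseudoMetricSpace X] [MeasurableSpace X] [BorelSpace X]
  [SecondCountableTopology X] {μ : Measure X} {Q β p r : ℝ} {c A : ℝ≥0∞}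

lemma IsAhlforsRegular.ae_le_maximalFunction_withDensity (hμ : IsAhlforsRegular μ Q c A)
    (hQ : 0 < Q) (hc : c ≠ 0) (hA : A ≠ ∞) {U : X → ℝ≥0∞} (hU : AEMeasurable U μ)
    (hfin : ∀ x : X, μ.withDensity U (ball x 1) ≠ ∞) :
    ∀ᵐ x ∂μ, U x ≤ ENNReal.ofReal 2 ^ Q / c * maximalFunction Q (μ.withDensity U) x := by
  have := hμ.isUnifLocDoublingMeasure hQ hc hA
  have := hμ.hasBallGrowth.isLocallyFiniteMeasure hA
  have := isLocallyFiniteMeasure_of_measure_ball_ne_top hfin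
  filter_upwards [VitaliFamily.ae_tendsto_rnDeriv (IsUnifLocDoublingMeasure.vitaliFamily μ 1)
    (μ.withDensity U), Measure.rnDeriv_withDensity₀ μ hU] with x hx hUx
  rw [hUx] at hx
  set ν := μ.withDensity U
  have hlim : Tendsto (fun t => ν (closedBall x t) / μ (closedBall x t)) (𝓝[>] 0) (𝓝 (U x)) :=
    hx.comp (IsUnifLocDoublingMeasure.tendsto_closedBall_filterAt (K := 1) μ
      (fun _ => x) (fun t => t) tendsto_id (eventually_nhdsWithin_of_forall fun t (ht : 0 < t) =>
        mem_closedBall_self (by linarith)))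
  refine le_of_tendsto hlim (eventually_nhdsWithin_of_forall fun t (ht : 0 < t) => ?_)
  calc ν (closedBall x t) / μ (closedBall x t) ≤ ν (ball x (2 * t)) / μ (ball x t) := by
        gcongr
        · exact closedBall_subset_ball (by linarith)
        · exact ball_subset_closedBall
    _ ≤ maximalFunction Q ν x * ENNReal.ofReal (2 * t) ^ Q / (c * ENNReal.ofReal t ^ Q) := by
        gcongr
        · exact measure_ball_le_maximalFunction_mul Q ν x (by linarith)
        · exact hμ.le_measure_ball x t ht
    _ = maximalFunction Q ν x * ENNReal.ofReal 2 ^ Q / c := by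
        rw [ofReal_mul_rpow (by norm_num) hQ.le, ← mul_assoc,
          ENNReal.mul_div_mul_right _ _ (ofReal_rpow_ne_zero ht Q) (ofReal_rpow_ne_top ht Q)]
    _ = ENNReal.ofReal 2 ^ Q / c * maximalFunction Q ν x := by
        rw [mul_comm, ENNReal.mul_div_right_comm]

lemma exists_schur_exponent (hp : 1 < p) (hr : 1 < r) :
    ∃ θ : ℝ, 1 / (p * r) < θ ∧ θ < 1 ∧ 1 / r + (θ - 1 / (p * r)) * (p - 1) < 1 := by
  have hpr : 1 / (p * r) < 1 := (div_lt_one (by positivity)).2 (by nlinarith)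
  have hr1 : 0 < 1 - 1 / r := sub_pos.2 ((div_lt_one (by positivity)).2 hr)
  have hp1 : 0 < p - 1 := by linarith
  obtain ⟨θ, hθ, hθ'⟩ := exists_between (show 1 / (p * r) <
      min 1 (1 / (p * r) + (1 - 1 / r) / (p - 1)) from
    lt_min hpr (lt_add_of_pos_right _ (div_pos hr1 hp1)))
  refine ⟨θ, hθ, hθ'.trans_le (min_le_left _ _), ?_⟩
  have : θ - 1 / (p * r) < (1 - 1 / r) / (p - 1) := by
    linarith [hθ'.trans_le (min_le_right _ _)]
  linarith [(lt_div_iff₀ hp1).1 this]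

/-- With `σ = 1 / (p r)`, the supersolution estimates at the exponents `θ` and
`θ' = 1 / r + (θ - σ) (p - 1)` compose, because `θ' - σ = θ (p - 1)`. -/
lemma HasBallGrowth.exists_rieszPotential_schur_le [SFinite μ] (hμ : HasBallGrowth μ Q A)
    (hA : A ≠ ∞) (hβ : 0 < β) (hβQ : β < Q) (hp : 1 < p) (hr : 1 < r) :
    ∃ θ : ℝ, 0 < θ ∧ ∃ C : ℝ≥0∞, C ≠ ∞ ∧ ∀ (ν : Measure X) (H : ℝ≥0∞), H ≠ ∞ →
      HasBallGrowth ν (Q - β * p * r) H → ∀ x,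
      rieszPotential μ Q β (fun y => maximalFunction Q ν y ^ (1 / r) *
        rieszPotential μ Q β (fun z => maximalFunction Q ν z ^ θ) y ^ (p - 1)) x ≤
          C * H ^ (1 / r) * (maximalFunction Q ν x ^ θ) ^ (p - 1) := by
  have hp1 : 0 < p - 1 := by linarith
  set σ := 1 / (p * r) with hσ
  have hσ0 : 0 < σ := by positivity
  have hσβ : β / (β * p * r) = σ := by rw [hσ, mul_assoc, div_mul_cancel_left₀ hβ.ne', one_div]
  have hσp : σ * p = 1 / r := by rw [hσ]; field_simp
  obtain ⟨θ, hθ, hθ1, hθ'1⟩ := exists_schur_exponent hp hr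
  set θ' := 1 / r + (θ - σ) * (p - 1) with hθ'
  have hθσ : 0 < (θ - σ) * (p - 1) := mul_pos (sub_pos.2 hθ) hp1
  have hσθ' : σ < θ' := by nlinarith
  have hexp : θ' - σ = θ * (p - 1) := by rw [hθ', ← hσp]; ring
  obtain ⟨C₁, hC₁, h₁⟩ := hμ.exists_rieszPotential_maximalFunction_rpow_le hA hβ hβQ
    (l := β * p * r) (by positivity) (hσβ.trans_lt hθ) hθ1
  obtain ⟨C₂, hC₂, h₂⟩ := hμ.exists_rieszPotential_maximalFunction_rpow_le hA hβ hβQ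
    (l := β * p * r) (by positivity) (hσβ.trans_lt hσθ') hθ'1
  rw [hσβ] at h₁ h₂
  refine ⟨θ, hσ0.trans hθ, C₁ ^ (p - 1) * C₂, by finiteness, fun ν H hH hν x => ?_⟩
  set m := maximalFunction Q ν
  set D := C₁ ^ (p - 1) * H ^ (σ * (p - 1))
  have hpoint (y : X) : m y ^ (1 / r) * rieszPotential μ Q β (fun z => m z ^ θ) y ^ (p - 1) ≤
      D * m y ^ θ' := by
    calc m y ^ (1 / r) * rieszPotential μ Q β (fun z => m z ^ θ) y ^ (p - 1)
        ≤ m y ^ (1 / r) * (C₁ * (H ^ σ * m y ^ (θ - σ))) ^ (p - 1) := by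
          gcongr
          exact h₁ ν H hH hν y
      _ = D * (m y ^ (1 / r) * m y ^ ((θ - σ) * (p - 1))) := by
          rw [ENNReal.mul_rpow_of_nonneg _ _ hp1.le, ENNReal.mul_rpow_of_nonneg _ _ hp1.le,
            ← ENNReal.rpow_mul, ← ENNReal.rpow_mul]
          ring
      _ = D * m y ^ θ' := by
          rw [← ENNReal.rpow_add_of_nonneg _ _ (by positivity) hθσ.le]
  calc rieszPotential μ Q β
        (fun y => m y ^ (1 / r) * rieszPotential μ Q β (fun z => m z ^ θ) y ^ (p - 1)) x
      ≤ rieszPotential μ Q β (fun y => D * m y ^ θ') x := rieszPotential_mono hpoint x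
    _ = D * rieszPotential μ Q β (fun y => m y ^ θ') x :=
        rieszPotential_const_mul D (by fun_prop) x
    _ ≤ D * (C₂ * (H ^ σ * m x ^ (θ' - σ))) := by
        gcongr
        exact h₂ ν H hH hν x
    _ = C₁ ^ (p - 1) * C₂ * (H ^ (σ * (p - 1)) * H ^ σ) * m x ^ (θ' - σ) := by ring
    _ = C₁ ^ (p - 1) * C₂ * H ^ (1 / r) * (m x ^ θ) ^ (p - 1) := by
        rw [← ENNReal.rpow_add_of_nonneg _ _ (by positivity) hσ0.le, hexp, ENNReal.rpow_mul, ← hσp]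
        ring_nf

lemma HasBallGrowth.exists_lintegral_maximalFunction_mul_rieszPotential_le
    (hμ : HasBallGrowth μ Q A) (hA : A ≠ ∞) (hβ : 0 < β) (hβQ : β < Q) (hp : 1 < p) (hr : 1 < r) :
    ∃ C : ℝ≥0∞, C ≠ ∞ ∧ ∀ (ν : Measure X) (H : ℝ≥0∞), ν ≠ 0 → H ≠ ∞ →
      HasBallGrowth ν (Q - β * p * r) H → ∀ f : X → ℝ≥0∞, AEMeasurable f μ →
        ∫⁻ x, maximalFunction Q ν x ^ (1 / r) * rieszPotential μ Q β f x ^ p ∂μ ≤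
          C * H ^ (1 / r) * ∫⁻ x, f x ^ p ∂μ := by
  have := hμ.isLocallyFiniteMeasure hA
  obtain ⟨θ, hθ, C, hC, hschur⟩ := hμ.exists_rieszPotential_schur_le hA hβ hβQ hp hr
  refine ⟨C, hC, fun ν H hν0 hH hν f hf => ?_⟩
  have hfin := hμ.ae_maximalFunction_ne_top (hβ.trans hβQ) hA hν (by positivity) hH
  refine lintegral_mul_rpow_lintegral_le_of_schur
    (k := fun x y => ENNReal.ofReal (dist x y ^ (β - Q))) (by unfold Function.uncurry; fun_prop)
    hp (by fun_prop) (ψ := fun y => maximalFunction Q ν y ^ θ) (by fun_prop) hf ?_ ?_ fun y => ?_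
  · filter_upwards [hfin] with x hx
    simp [ENNReal.rpow_eq_zero_iff, maximalFunction_ne_zero hν0 x, hx]
  · filter_upwards [hfin] with x hx using ENNReal.rpow_ne_top_of_nonneg hθ.le hx
  · simp only [dist_comm _ y]
    exact hschur ν H hH hν y

/-- The Fefferman–Phong trace inequality. -/
theorem IsAhlforsRegular.exists_lintegral_mul_rieszPotential_rpow_le
    (hμ : IsAhlforsRegular μ Q c A) (hc : c ≠ 0) (hA : A ≠ ∞) (hβ : 0 < β) (hβQ : β < Q)
    (hp : 1 < p) (hr : 1 < r) :
    ∃ C : ℝ≥0∞, C ≠ ∞ ∧ ∀ (V : X → ℝ≥0∞) (H : ℝ≥0∞), AEMeasurable V μ → H ≠ ∞ →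
      HasBallGrowth (μ.withDensity fun x => V x ^ r) (Q - β * p * r) H →
      ∀ f : X → ℝ≥0∞, AEMeasurable f μ →
        ∫⁻ x, V x * rieszPotential μ Q β f x ^ p ∂μ ≤ C * H ^ (1 / r) * ∫⁻ x, f x ^ p ∂μ := by
  have hr0 : 0 < r := by linarith
  have := hμ.hasBallGrowth.isLocallyFiniteMeasure hA
  obtain ⟨C, hC, htrace⟩ := hμ.hasBallGrowth.exists_lintegral_maximalFunction_mul_rieszPotential_le
    hA hβ hβQ hp hr
  set K : ℝ≥0∞ := (ENNReal.ofReal 2 ^ Q / c) ^ (1 / r)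
  have hK : K ≠ ∞ := ENNReal.rpow_ne_top_of_nonneg (by positivity)
    (ENNReal.div_ne_top (ofReal_rpow_ne_top (by norm_num) Q) hc)
  refine ⟨K * C, by finiteness, fun V H hV hH hν f hf => ?_⟩
  set ν := μ.withDensity fun x => V x ^ r
  rcases eq_or_ne ν 0 with hν0 | hν0
  · have hV0 : ∀ᵐ x ∂μ, V x = 0 := by
      filter_upwards [(withDensity_eq_zero_iff (hV.pow_const r)).1 hν0] with x hx
      exact (ENNReal.rpow_eq_zero_iff_of_pos hr0).1 hx
    rw [lintegral_congr_ae (g := 0) (by filter_upwards [hV0] with x hx; simp [hx])]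
    simp
  have hVm : ∀ᵐ x ∂μ, V x ≤ K * maximalFunction Q ν x ^ (1 / r) := by
    filter_upwards [hμ.ae_le_maximalFunction_withDensity (hβ.trans hβQ) hc hA (hV.pow_const r)
      fun x => hν.measure_ball_ne_top hH x one_pos] with x hx
    rw [← ENNReal.mul_rpow_of_nonneg _ _ (by positivity), one_div]
    exact (ENNReal.le_rpow_inv_iff hr0).2 hx
  calc ∫⁻ x, V x * rieszPotential μ Q β f x ^ p ∂μ
      ≤ ∫⁻ x, K * (maximalFunction Q ν x ^ (1 / r) * rieszPotential μ Q β f x ^ p) ∂μ := by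
        refine lintegral_mono_ae ?_
        filter_upwards [hVm] with x hx
        rw [← mul_assoc]
        gcongr
    _ = K * ∫⁻ x, maximalFunction Q ν x ^ (1 / r) * rieszPotential μ Q β f x ^ p ∂μ :=
        lintegral_const_mul' _ _ hK
    _ ≤ K * (C * H ^ (1 / r) * ∫⁻ x, f x ^ p ∂μ) := by
        gcongr
        exact htrace ν H hν0 hH hν f hf
    _ = K * C * H ^ (1 / r) * ∫⁻ x, f x ^ p ∂μ := by ring

end TraceInequality

section ParabolicGeometry

/-- The parabolic gauge `max (|t| ^ (1 / α)) |x|`, homogeneous of degree one under the dilations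
`(t, x) ↦ (r ^ α t, r x)`. -/
noncomputable def parabolicNorm {d : ℕ} (α : ℝ) (z : SpaceTime d) : ℝ :=
  max (|z.1| ^ (1 / α)) ‖z.2‖

lemma parabolicNorm_lt_iff {d : ℕ} {α ρ : ℝ} (hα : 0 < α) (hρ : 0 < ρ) {z : SpaceTime d} :
    parabolicNorm α z < ρ ↔ |z.1| < ρ ^ α ∧ ‖z.2‖ < ρ := by
  rw [parabolicNorm, max_lt_iff, one_div, Real.rpow_inv_lt_iff_of_pos (abs_nonneg _) hρ.le hα]

lemma measurable_parabolicNorm (d : ℕ) (α : ℝ) :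
    Measurable (parabolicNorm α : SpaceTime d → ℝ) := by
  unfold parabolicNorm
  fun_prop

lemma isEmbedding_toSnowflaking_prod (X Y : Type*) [PseudoMetricSpace X] [TopologicalSpace Y]
    {a : ℝ} (ha0 : 0 < a) (ha1 : a ≤ 1) :
    IsEmbedding fun z : X × Y => ((Snowflaking.toSnowflaking z.1 : Snowflaking X a ha0 ha1), z.2) :=
  (Snowflaking.homeomorph.symm.isEmbedding (X := X) (Y := Snowflaking X a ha0 ha1)).prodMap
    IsEmbedding.id

/-- The metric on space-time given by the parabolic gauge: the product of the snowflaked time axis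
and Euclidean space. Pulling it back along an embedding keeps the usual topology definitionally. -/
noncomputable abbrev parabolicMetric (d : ℕ) {α : ℝ} (hα : 1 ≤ α) : MetricSpace (SpaceTime d) :=
  (isEmbedding_toSnowflaking_prod ℝ (EuclideanSpace ℝ (Fin d)) (a := 1 / α) (by positivity)
    ((div_le_one (by positivity)).2 hα)).comapMetricSpace _

lemma parabolicMetric_dist (d : ℕ) {α : ℝ} (hα : 1 ≤ α) (z w : SpaceTime d) :
    @dist _ (parabolicMetric d hα).toDist z w = parabolicNorm α (z - w) := by
  change max (dist (Snowflaking.toSnowflaking z.1 : Snowflaking ℝ (1 / α) _ _)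
    (Snowflaking.toSnowflaking w.1)) (dist z.2 w.2) = _
  rw [Snowflaking.dist_toSnowflaking_toSnowflaking, Real.dist_eq, dist_eq_norm]
  rfl

lemma parabolicMetric_ball (d : ℕ) {α : ℝ} (hα : 1 ≤ α) (z : SpaceTime d) (t : ℝ) :
    @ball _ (parabolicMetric d hα).toPseudoMetricSpace z t =
      {w | parabolicNorm α (w - z) < t} := by
  ext w
  rw [mem_ofPred_eq, ← parabolicMetric_dist d hα]
  rfl

lemma volume_setOf_parabolicNorm_sub_lt (d : ℕ) {α ρ : ℝ} (hα : 0 < α) (hρ : 0 < ρ)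
    (z : SpaceTime d) :
    volume {w : SpaceTime d | parabolicNorm α (w - z) < ρ} =
      2 * volume (ball (0 : EuclideanSpace ℝ (Fin d)) 1) * ENNReal.ofReal ρ ^ (d + α) := by
  have : {w : SpaceTime d | parabolicNorm α (w - z) < ρ} = ball z.1 (ρ ^ α) ×ˢ ball z.2 ρ := by
    ext w
    simp [parabolicNorm_lt_iff hα hρ, dist_eq_norm]
  rw [this, Measure.volume_eq_prod, Measure.prod_prod, Real.volume_ball,
    Measure.addHaar_ball_of_pos _ _ hρ, finrank_euclideanSpace_fin,
    ENNReal.rpow_add _ _ (by simpa using hρ) ENNReal.ofReal_ne_top, ENNReal.rpow_natCast,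
    ENNReal.ofReal_rpow_of_pos hρ, ENNReal.ofReal_mul (by norm_num), ENNReal.ofReal_pow hρ.le,
    ENNReal.ofReal_ofNat]
  ring

lemma isAhlforsRegular_parabolicMetric (d : ℕ) {α : ℝ} (hα : 1 ≤ α) :
    @IsAhlforsRegular (SpaceTime d) (parabolicMetric d hα).toPseudoMetricSpace _ volume (d + α)
      (2 * volume (ball (0 : EuclideanSpace ℝ (Fin d)) 1))
      (2 * volume (ball (0 : EuclideanSpace ℝ (Fin d)) 1)) := by
  have h (z : SpaceTime d) (t : ℝ) (ht : 0 < t) := parabolicMetric_ball d hα z t ▸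
    volume_setOf_parabolicNorm_sub_lt d (by positivity) ht z
  exact @IsAhlforsRegular.mk _ (parabolicMetric d hα).toPseudoMetricSpace _ _ _ _ _
    (fun z t ht => (h z t ht).ge) (fun z t ht => (h z t ht).le)

end ParabolicGeometry

section MorreyCylinders

lemma volume_cylinder (d : ℕ) (α : ℝ) {ρ : ℝ} (hρ : 0 < ρ) (z : SpaceTime d) :
    volume (cylinder d α ρ z) =
      volume (ball (0 : EuclideanSpace ℝ (Fin d)) 1) * ENNReal.ofReal ρ ^ (d + α) := by
  have : cylinder d α ρ z = Icc z.1 (z.1 + ρ ^ α) ×ˢ closedBall z.2 ρ := by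
    ext w
    simp [cylinder, dist_eq_norm, and_assoc]
  rw [this, Measure.volume_eq_prod, Measure.prod_prod, Real.volume_Icc,
    Measure.addHaar_closedBall _ _ hρ.le, finrank_euclideanSpace_fin,
    ENNReal.rpow_add _ _ (by simpa using hρ) ENNReal.ofReal_ne_top, ENNReal.rpow_natCast,
    ENNReal.ofReal_rpow_of_pos hρ, ENNReal.ofReal_pow hρ.le, add_sub_cancel_left]
  ring

lemma setLIntegral_cylinder_le {d : ℕ} {α q ρ : ℝ} (hq : 0 < q) (hρ : 0 < ρ)
    (v : SpaceTime d → ℝ) (z : SpaceTime d) :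
    ∫⁻ w in cylinder d α ρ z, ‖v w‖ₑ ^ q ≤
      volume (ball (0 : EuclideanSpace ℝ (Fin d)) 1) * morreyNorm d α q v ^ q *
        ENNReal.ofReal ρ ^ (d + α - q) := by
  have hρ0 : ENNReal.ofReal ρ ≠ 0 := by simpa using hρ
  set ω := volume (ball (0 : EuclideanSpace ℝ (Fin d)) 1)
  set J := ∫⁻ w in cylinder d α ρ z, ‖v w‖ₑ ^ q
  set S := volume (cylinder d α ρ z)
  have hS : S = ω * ENNReal.ofReal ρ ^ (d + α) := volume_cylinder d α hρ z
  have hS0 : S ≠ 0 := hS ▸ mul_ne_zero (measure_ball_pos _ _ one_pos).ne'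
    (ofReal_rpow_ne_zero hρ _)
  have hS_top : S ≠ ∞ := hS ▸ ENNReal.mul_ne_top measure_ball_lt_top.ne (ofReal_rpow_ne_top hρ _)
  have h : ENNReal.ofReal ρ * (S⁻¹ * J) ^ (1 / q) ≤ morreyNorm d α q v :=
    le_iSup_of_le ρ <| le_iSup_of_le hρ <| le_iSup_of_le z le_rfl
  have hpow : S⁻¹ * J ≤ (morreyNorm d α q v / ENNReal.ofReal ρ) ^ q := by
    rw [← ENNReal.rpow_inv_le_iff hq, ← one_div q,
      ENNReal.le_div_iff_mul_le (.inl hρ0) (.inl ENNReal.ofReal_ne_top), mul_comm]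
    exact h
  calc J = S * (S⁻¹ * J) := by rw [ENNReal.mul_inv_cancel_left hS0 hS_top]
    _ ≤ S * (morreyNorm d α q v / ENNReal.ofReal ρ) ^ q := by gcongr
    _ = _ := by
      rw [hS, ENNReal.div_rpow_of_nonneg _ _ hq.le, ENNReal.rpow_sub _ _ hρ0 ENNReal.ofReal_ne_top]
      simp only [div_eq_mul_inv]
      ring

lemma setLIntegral_parabolicNorm_sub_lt_le {d : ℕ} {α q ρ : ℝ} (hα : 0 < α) (hq : 0 < q)
    (hρ : 0 < ρ) (v : SpaceTime d → ℝ) (z : SpaceTime d) :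
    ∫⁻ w in {w | parabolicNorm α (w - z) < ρ}, ‖v w‖ₑ ^ q ≤
      2 * volume (ball (0 : EuclideanSpace ℝ (Fin d)) 1) * morreyNorm d α q v ^ q *
        ENNReal.ofReal ρ ^ (d + α - q) := by
  -- Cylinders only look forward in time, so a parabolic ball is covered by two of them.
  have hsub : {w | parabolicNorm α (w - z) < ρ} ⊆
      cylinder d α ρ z ∪ cylinder d α ρ (z.1 - ρ ^ α, z.2) := by
    intro w hw
    obtain ⟨ht, hx⟩ := (parabolicNorm_lt_iff hα hρ).1 hw
    rw [Prod.fst_sub, abs_lt] at ht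
    rcases le_total z.1 w.1 with h | h
    · exact Or.inl ⟨h, by linarith, hx.le⟩
    · exact Or.inr ⟨by dsimp only; linarith, by dsimp only; linarith, hx.le⟩
  calc _ ≤ _ := (lintegral_mono_set hsub).trans (lintegral_union_le _ _ _)
    _ ≤ _ := add_le_add (setLIntegral_cylinder_le hq hρ v _) (setLIntegral_cylinder_le hq hρ v _)
    _ = _ := by ring

end MorreyCylinders

section ParabolicPotential

/-- The potential of order `β` for the parabolic gauge, `∫ |z - y|_α ^ (β - (d + α)) g(y) dy`; the
homogeneous dimension of space-time is `d + α`. -/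
noncomputable def parabolicPotential {d : ℕ} (α β : ℝ) (g : SpaceTime d → ℝ≥0∞)
    (z : SpaceTime d) : ℝ≥0∞ :=
  ∫⁻ y, ENNReal.ofReal (parabolicNorm α (z - y) ^ (β - (d + α))) * g y

lemma exists_lintegral_mul_parabolicPotential_rpow_le (d : ℕ) {α β p r : ℝ} (hα : 1 ≤ α)
    (hβ : 0 < β) (hβQ : β < d + α) (hp : 1 < p) (hr : 1 < r) :
    ∃ C : ℝ≥0∞, C ≠ ∞ ∧ ∀ (V : SpaceTime d → ℝ≥0∞) (H : ℝ≥0∞), AEMeasurable V → H ≠ ∞ →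
      (∀ (z : SpaceTime d) (t : ℝ), 0 < t →
        ∫⁻ y in {y | parabolicNorm α (y - z) < t}, V y ^ r ≤
          H * ENNReal.ofReal t ^ (d + α - β * p * r)) →
      ∀ g : SpaceTime d → ℝ≥0∞, AEMeasurable g →
        ∫⁻ z, V z * parabolicPotential α β g z ^ p ≤ C * H ^ (1 / r) * ∫⁻ z, g z ^ p := by
  let m : PseudoMetricSpace (SpaceTime d) := (parabolicMetric d hα).toPseudoMetricSpace
  have hBorel : @BorelSpace (SpaceTime d) m.toUniformSpace.toTopologicalSpace _ :=
    inferInstanceAs (BorelSpace (ℝ × EuclideanSpace ℝ (Fin d)))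
  have hSecond : @SecondCountableTopology (SpaceTime d) m.toUniformSpace.toTopologicalSpace :=
    inferInstanceAs (SecondCountableTopology (ℝ × EuclideanSpace ℝ (Fin d)))
  have hω0 : 2 * volume (ball (0 : EuclideanSpace ℝ (Fin d)) 1) ≠ 0 :=
    mul_ne_zero (by simp) (measure_ball_pos _ _ one_pos).ne'
  have hωtop : 2 * volume (ball (0 : EuclideanSpace ℝ (Fin d)) 1) ≠ ∞ :=
    ENNReal.mul_ne_top (by simp) measure_ball_lt_top.ne
  obtain ⟨C, hC, htrace⟩ := isAhlforsRegular_parabolicMetric d hα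
    |>.exists_lintegral_mul_rieszPotential_rpow_le hω0 hωtop hβ hβQ hp hr
  have hpot (g : SpaceTime d → ℝ≥0∞) (z : SpaceTime d) :
      @rieszPotential _ m _ volume (d + α) β g z = parabolicPotential α β g z := by
    simp only [rieszPotential, parabolicPotential, m, parabolicMetric_dist]
  refine ⟨C, hC, fun V H hV hH hmorrey g hg => ?_⟩
  simp only [← hpot]
  refine htrace V H hV hH (fun z t ht => ?_) g hg
  rw [withDensity_apply _ measurableSet_ball, parabolicMetric_ball]
  exact hmorrey z t ht

end ParabolicPotential

section KernelPotential

instance (d : ℕ) : (volume : Measure (SpaceTime d)).IsAddHaarMeasure :=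
  Measure.prod.instIsAddHaarMeasure _ _

lemma measurable_kernel (d : ℕ) (α γ : ℝ) : Measurable (kernel d α γ) := by
  unfold kernel
  exact Measurable.ite (measurableSet_lt (by fun_prop) (by fun_prop))
    (Measurable.ite (measurableSet_le (by fun_prop) (by fun_prop)) (by fun_prop) (by fun_prop))
    measurable_const

lemma kernel_nonneg (d : ℕ) (α γ : ℝ) (z : SpaceTime d) : 0 ≤ kernel d α γ z := by
  unfold kernel
  split_ifs <;> positivity

lemma kernel_le_parabolicNorm_rpow {d : ℕ} {α β γ : ℝ} (hβ : 0 ≤ β) (hγ : γ / 2 = β / α)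
    (z : SpaceTime d) : kernel d α γ z ≤ parabolicNorm α z ^ (β - (d + α)) := by
  unfold kernel
  split_ifs with ht hx
  · have hz : 0 < ‖z.2‖ := lt_of_lt_of_le (by positivity) hx
    have hnorm : parabolicNorm α z = ‖z.2‖ := by
      rw [parabolicNorm, abs_of_pos ht, max_eq_right hx]
    calc z.1 ^ (γ / 2) * ‖z.2‖ ^ (-(d : ℝ) - α)
        = (z.1 ^ (1 / α)) ^ β * ‖z.2‖ ^ (-(d : ℝ) - α) := by
          rw [hγ, ← Real.rpow_mul ht.le, one_div_mul_eq_div]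
      _ ≤ ‖z.2‖ ^ β * ‖z.2‖ ^ (-(d : ℝ) - α) := by gcongr
      _ = parabolicNorm α z ^ (β - (d + α)) := by
          rw [← Real.rpow_add hz, hnorm]
          ring_nf
  · have hnorm : parabolicNorm α z = z.1 ^ (1 / α) := by
      rw [parabolicNorm, abs_of_pos ht, max_eq_left (not_le.1 hx).le]
    rw [hnorm, ← Real.rpow_mul ht.le, hγ, one_div_mul_eq_div, sub_div]
  · exact Real.rpow_nonneg (le_max_of_le_right (norm_nonneg _)) _

/-- The potential `∫ p_γ(w) f(z + S w) dw`, a common form of `P_γ` (`S = id`) and `P_γ^*` (`S` the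
reflection of time). -/
noncomputable def kernelPotential (d : ℕ) (α γ : ℝ) (S : SpaceTime d → SpaceTime d)
    (f : SpaceTime d → ℝ) (z : SpaceTime d) : ℝ :=
  ∫ w, kernel d α γ w * f (z + S w)

lemma kernelPotential_id (d : ℕ) (α γ : ℝ) (f : SpaceTime d → ℝ) :
    kernelPotential d α γ id f = P d α γ f :=
  rfl

lemma kernelPotential_neg_time (d : ℕ) (α γ : ℝ) (f : SpaceTime d → ℝ) :
    kernelPotential d α γ (Prod.map Neg.neg id) f = PStar d α γ f := by
  ext z
  simp only [kernelPotential, PStar, sub_eq_add_neg]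
  rfl

variable {d : ℕ} {α β γ : ℝ} {S : SpaceTime d → SpaceTime d} {f : SpaceTime d → ℝ}

lemma aestronglyMeasurable_kernelPotential (hS : Measurable S) (hf : AEStronglyMeasurable f) :
    AEStronglyMeasurable (kernelPotential d α γ S f) := by
  have hshift : Measure.QuasiMeasurePreserving (fun v : SpaceTime d × SpaceTime d => v.1 + S v.2)
      (volume.prod volume) volume :=
    QuasiMeasurePreserving.prod_of_left (by fun_prop) <| ae_of_all _ fun w =>
      (measurePreserving_add_right volume (S w)).quasiMeasurePreserving
  have hkernel : Measurable fun v : SpaceTime d × SpaceTime d => kernel d α γ v.2 :=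
    (measurable_kernel d α γ).comp measurable_snd
  exact (hkernel.aestronglyMeasurable.mul
    (hf.comp_quasiMeasurePreserving hshift)).integral_prod_right'

lemma enorm_kernelPotential_le (hβ : 0 ≤ β) (hγ : γ / 2 = β / α) (hS : MeasurePreserving S)
    (hSnorm : ∀ w, parabolicNorm α (S w) = parabolicNorm α w) (hf : AEStronglyMeasurable f)
    (z : SpaceTime d) :
    ‖kernelPotential d α γ S f z‖ₑ ≤ parabolicPotential α β (fun y => ‖f y‖ₑ) z := by
  have hshift : MeasurePreserving fun w => z + S w := (measurePreserving_add_left volume z).comp hS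
  have hnorm (w : SpaceTime d) : parabolicNorm α (z - (z + S w)) = parabolicNorm α w := by
    rw [sub_add_cancel_left, ← hSnorm w]
    simp [parabolicNorm]
  have hmeas : AEMeasurable fun y : SpaceTime d =>
      ENNReal.ofReal (parabolicNorm α (z - y) ^ (β - (d + α))) * ‖f y‖ₑ := by
    have := measurable_parabolicNorm d α
    exact (by fun_prop : Measurable fun y : SpaceTime d =>
      ENNReal.ofReal (parabolicNorm α (z - y) ^ (β - (d + α)))).aemeasurable.mul hf.enorm
  calc ‖kernelPotential d α γ S f z‖ₑ ≤ ∫⁻ w, ‖kernel d α γ w * f (z + S w)‖ₑ :=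
        enorm_integral_le_lintegral_enorm _
    _ ≤ ∫⁻ w, ENNReal.ofReal (parabolicNorm α (z - (z + S w)) ^ (β - (d + α))) *
          ‖f (z + S w)‖ₑ := by
        refine lintegral_mono fun w => ?_
        rw [enorm_mul, Real.enorm_of_nonneg (kernel_nonneg d α γ w), hnorm]
        gcongr
        exact kernel_le_parabolicNorm_rpow hβ hγ w
    _ = parabolicPotential α β (fun y => ‖f y‖ₑ) z := by
        rw [parabolicPotential]
        conv_rhs => rw [← hshift.map_eq]
        exact (lintegral_map' (hshift.map_eq.symm ▸ hmeas) hshift.aemeasurable).symm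

end KernelPotential

section MorreyWeights

lemma aemeasurable_enorm_of_norm_rpow {Y E : Type*} [MeasurableSpace Y] {μ : Measure Y}
    [NormedAddCommGroup E] {b : Y → E} {s : ℝ} (hs : s ≠ 0)
    (h : AEMeasurable (fun z => ‖b z‖ ^ s) μ) : AEMeasurable (fun z => ‖b z‖ₑ) μ := by
  have : (fun z => ‖b z‖ₑ) = fun z => ENNReal.ofReal ((‖b z‖ ^ s) ^ s⁻¹) := by
    ext z
    rw [Real.rpow_rpow_inv (norm_nonneg _) hs, ofReal_norm]
  rw [this]
  exact (h.pow_const _).ennreal_ofReal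

lemma integral_le_toReal_of_lintegral_enorm_le {Y : Type*} [MeasurableSpace Y] {μ : Measure Y}
    {g : Y → ℝ} {M : ℝ≥0∞} (hM : M ≠ ∞) (h : ∫⁻ z, ‖g z‖ₑ ∂μ ≤ M) : ∫ z, g z ∂μ ≤ M.toReal :=
  calc ∫ z, g z ∂μ ≤ ‖∫ z, g z ∂μ‖ := le_abs_self _
    _ = ‖∫ z, g z ∂μ‖ₑ.toReal := (toReal_enorm _).symm
    _ ≤ M.toReal := ENNReal.toReal_mono hM ((enorm_integral_le_lintegral_enorm _).trans h)

variable {E : Type*} [NormedAddCommGroup E] (d : ℕ) {α β p q : ℝ}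

lemma exists_lintegral_enorm_mul_parabolicPotential_rpow_le (hα : 1 < α) (hq : α - 1 < q)
    (hp : 1 < p) (hβ : β * p = α - 1) :
    ∃ C : ℝ≥0∞, C ≠ ∞ ∧ ∀ b : SpaceTime d → E,
      MemMorrey d α q (fun z => ‖b z‖ ^ (1 / (α - 1))) →
      ∀ g : SpaceTime d → ℝ≥0∞, AEMeasurable g →
        ∫⁻ z, ‖b z‖ₑ * parabolicPotential α β g z ^ p ≤
          C * morreyNorm d α q (fun z => ‖b z‖ ^ (1 / (α - 1))) ^ (α - 1) * ∫⁻ z, g z ^ p := by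
  have hα1 : 0 < α - 1 := by linarith
  have hq0 : 0 < q := hα1.trans hq
  have hβ0 : 0 < β := pos_of_mul_pos_left (hβ ▸ hα1) (by linarith)
  have hβQ : β < d + α := by
    have : (0 : ℝ) ≤ d := Nat.cast_nonneg d
    nlinarith
  obtain ⟨C, hC, htrace⟩ := exists_lintegral_mul_parabolicPotential_rpow_le d hα.le hβ0 hβQ hp
    ((one_lt_div hα1).2 hq)
  set ω := 2 * volume (ball (0 : EuclideanSpace ℝ (Fin d)) 1)
  have hω : ω ≠ ∞ := ENNReal.mul_ne_top (by simp) measure_ball_lt_top.ne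
  refine ⟨C * ω ^ ((α - 1) / q),
    ENNReal.mul_ne_top hC (ENNReal.rpow_ne_top_of_nonneg (by positivity) hω),
    fun b hb g hg => ?_⟩
  set K := morreyNorm d α q (fun z => ‖b z‖ ^ (1 / (α - 1)))
  have hK : K ≠ ∞ := hb.norm_lt_top.ne
  have hgrowth (z : SpaceTime d) (t : ℝ) (ht : 0 < t) :
      ∫⁻ y in {y | parabolicNorm α (y - z) < t}, ‖b y‖ₑ ^ (q / (α - 1)) ≤
        ω * K ^ q * ENNReal.ofReal t ^ (d + α - β * p * (q / (α - 1))) := by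
    rw [hβ, mul_div_cancel₀ _ hα1.ne']
    refine Eq.trans_le (lintegral_congr fun y => ?_)
      (setLIntegral_parabolicNorm_sub_lt_le (by positivity) hq0 ht _ z)
    rw [Real.enorm_rpow_of_nonneg (norm_nonneg _) (by positivity), enorm_norm,
      ← ENNReal.rpow_mul, one_div_mul_eq_div]
  have hexp : (ω * K ^ q) ^ (1 / (q / (α - 1))) = ω ^ ((α - 1) / q) * K ^ (α - 1) := by
    rw [one_div_div, ENNReal.mul_rpow_of_nonneg _ _ (by positivity), ← ENNReal.rpow_mul,
      mul_div_cancel₀ _ hq0.ne']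
  have hbm : AEMeasurable fun z => ‖b z‖ₑ :=
    aemeasurable_enorm_of_norm_rpow (by positivity) hb.aestronglyMeasurable.aemeasurable
  rw [mul_assoc C, ← hexp]
  exact htrace _ _ hbm (ENNReal.mul_ne_top hω (ENNReal.rpow_ne_top_of_nonneg hq0.le hK))
    hgrowth g hg

theorem exists_integral_norm_mul_kernelPotential_rpow_le {γ : ℝ} (hα : 1 < α) (hq : α - 1 < q)
    (hp : 1 < p) (hβ : β * p = α - 1) (hγ : γ / 2 = β / α) :
    ∃ C : ℝ, 0 < C ∧ ∀ b : SpaceTime d → E,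
      MemMorrey d α q (fun z => ‖b z‖ ^ (1 / (α - 1))) →
      ∀ f : SpaceTime d → ℝ, MemLp f (ENNReal.ofReal p) → ∀ S : SpaceTime d → SpaceTime d,
        MeasurePreserving S → (∀ w, parabolicNorm α (S w) = parabolicNorm α w) →
        Integrable (fun z => ‖b z‖ * |kernelPotential d α γ S f z| ^ p) ∧
          ∫ z, ‖b z‖ * |kernelPotential d α γ S f z| ^ p ≤
            C ^ p * (morreyNorm d α q (fun z => ‖b z‖ ^ (1 / (α - 1)))).toReal ^ (α - 1) *
              (eLpNorm f (ENNReal.ofReal p) volume).toReal ^ p := by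
  have hα1 : 0 < α - 1 := by linarith
  have hp0 : 0 < p := by linarith
  have hβ0 : 0 < β := pos_of_mul_pos_left (hβ ▸ hα1) hp0.le
  obtain ⟨D, hD, hpotential⟩ :=
    exists_lintegral_enorm_mul_parabolicPotential_rpow_le (E := E) d hα hq hp hβ
  refine ⟨(D.toReal + 1) ^ (1 / p), by positivity, fun b hb f hf S hS hSnorm => ?_⟩
  set K := morreyNorm d α q (fun z => ‖b z‖ ^ (1 / (α - 1)))
  set F := eLpNorm f (ENNReal.ofReal p) volume
  have hFpow : F ^ p = ∫⁻ y, ‖f y‖ₑ ^ p := by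
    simpa only [Real.coe_toNNReal p hp0.le, F, ENNReal.ofReal] using
      eLpNorm_nnreal_pow_eq_lintegral (f := f) (Real.toNNReal_pos.2 hp0).ne'
  have hbound : ∫⁻ z, ‖‖b z‖ * |kernelPotential d α γ S f z| ^ p‖ₑ ≤
      D * K ^ (α - 1) * F ^ p := by
    rw [hFpow]
    refine (lintegral_mono fun z => ?_).trans (hpotential b hb _ hf.aestronglyMeasurable.enorm)
    rw [enorm_mul, enorm_norm, Real.enorm_rpow_of_nonneg (abs_nonneg _) hp0.le, Real.enorm_abs]
    gcongr
    exact enorm_kernelPotential_le hβ0.le hγ hS hSnorm hf.aestronglyMeasurable z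
  have htop : D * K ^ (α - 1) * F ^ p ≠ ∞ :=
    ENNReal.mul_ne_top
      (ENNReal.mul_ne_top hD (ENNReal.rpow_ne_top_of_nonneg hα1.le hb.norm_lt_top.ne))
      (ENNReal.rpow_ne_top_of_nonneg hp0.le hf.eLpNorm_ne_top)
  have hbm : AEMeasurable fun z => ‖b z‖ := by
    simpa using (aemeasurable_enorm_of_norm_rpow (by positivity)
      hb.aestronglyMeasurable.aemeasurable).ennreal_toReal
  have hum := (aestronglyMeasurable_kernelPotential (α := α) (γ := γ) hS.measurable
    hf.aestronglyMeasurable).aemeasurable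
  refine ⟨⟨(hbm.mul (hum.abs.pow_const p)).aestronglyMeasurable, hbound.trans_lt htop.lt_top⟩, ?_⟩
  calc _ ≤ (D * K ^ (α - 1) * F ^ p).toReal := integral_le_toReal_of_lintegral_enorm_le htop hbound
    _ = D.toReal * K.toReal ^ (α - 1) * F.toReal ^ p := by
        rw [ENNReal.toReal_mul, ENNReal.toReal_mul, ← ENNReal.toReal_rpow, ← ENNReal.toReal_rpow]
    _ ≤ ((D.toReal + 1) ^ (1 / p)) ^ p * K.toReal ^ (α - 1) * F.toReal ^ p := by
        rw [← Real.rpow_mul (by positivity), one_div_mul_cancel hp0.ne', Real.rpow_one]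
        gcongr
        linarith

end MorreyWeights

end AdamsKrylov

/-- For `f` in `L^p` the integrals defining `P_γ f` and `P_γ^* f` converge almost everywhere, so
that no junk value of the Bochner integral enters. -/
theorem proposition1_general {E : Type*} [NormedAddCommGroup E] (d : ℕ) (α : ℝ) (hα : 1 < α)
    (q : ℝ) (hq : α - 1 < q) (p : ℝ) (hp : 1 < p) :
    ∃ C : ℝ, 0 < C ∧
      ∀ b : AdamsKrylov.SpaceTime d → E,
        AdamsKrylov.MemMorrey d α q (fun z => ‖b z‖ ^ (1 / (α - 1))) →
        ∀ f : AdamsKrylov.SpaceTime d → ℝ, MemLp f (ENNReal.ofReal p) volume →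
          (Integrable
              (fun z => ‖b z‖ * |AdamsKrylov.P d α ((1 - 1 / α) * (2 / p)) f z| ^ p) volume ∧
            ∫ z, ‖b z‖ * |AdamsKrylov.P d α ((1 - 1 / α) * (2 / p)) f z| ^ p ≤
              C ^ p *
                (AdamsKrylov.morreyNorm d α q (fun z => ‖b z‖ ^ (1 / (α - 1)))).toReal ^ (α - 1) *
                (eLpNorm f (ENNReal.ofReal p) volume).toReal ^ p) ∧
          (Integrable
              (fun z => ‖b z‖ * |AdamsKrylov.PStar d α ((1 - 1 / α) * (2 / p)) f z| ^ p) volume ∧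
            ∫ z, ‖b z‖ * |AdamsKrylov.PStar d α ((1 - 1 / α) * (2 / p)) f z| ^ p ≤
              C ^ p *
                (AdamsKrylov.morreyNorm d α q (fun z => ‖b z‖ ^ (1 / (α - 1)))).toReal ^ (α - 1) *
                (eLpNorm f (ENNReal.ofReal p) volume).toReal ^ p) := by
  have hβ : (α - 1) / p * p = α - 1 := div_mul_cancel₀ _ (by positivity)
  have hγ : (1 - 1 / α) * (2 / p) / 2 = (α - 1) / p / α := by field_simp
  obtain ⟨C, hC, h⟩ := AdamsKrylov.exists_integral_norm_mul_kernelPotential_rpow_le (E := E) d hα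
    hq hp hβ hγ
  refine ⟨C, hC, fun b hb f hf => ⟨?_, ?_⟩⟩
  · rw [← AdamsKrylov.kernelPotential_id]
    exact h b hb f hf id (.id volume) fun _ => rfl
  · rw [← AdamsKrylov.kernelPotential_neg_time]
    exact h b hb f hf _ ((Measure.measurePreserving_neg volume).prod (.id volume)) fun w => by
      simp [AdamsKrylov.parabolicNorm]

theorem proposition1 (d : ℕ) (hd : 2 ≤ d) (α : ℝ) (hα1 : 1 < α) (hα2 : α < 2)
    (q : ℝ) (hq1 : 1 < q) (hq2 : q < (d : ℝ) + α) (p : ℝ) (hp : 1 < p) :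
    ∃ C : ℝ, 0 < C ∧
      ∀ b : AdamsKrylov.SpaceTime d → EuclideanSpace ℝ (Fin d),
        AdamsKrylov.MemMorrey d α q (fun z => ‖b z‖ ^ (1 / (α - 1))) →
        ∀ f : AdamsKrylov.SpaceTime d → ℝ, Continuous f → HasCompactSupport f →
          (Integrable
              (fun z => ‖b z‖ * |AdamsKrylov.P d α ((1 - 1 / α) * (2 / p)) f z| ^ p) volume ∧
            ∫ z, ‖b z‖ * |AdamsKrylov.P d α ((1 - 1 / α) * (2 / p)) f z| ^ p ≤
              C ^ p *
                (AdamsKrylov.morreyNorm d α q (fun z => ‖b z‖ ^ (1 / (α - 1)))).toReal ^ (α - 1) *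
                (eLpNorm f (ENNReal.ofReal p) volume).toReal ^ p) ∧
          (Integrable
              (fun z => ‖b z‖ * |AdamsKrylov.PStar d α ((1 - 1 / α) * (2 / p)) f z| ^ p) volume ∧
            ∫ z, ‖b z‖ * |AdamsKrylov.PStar d α ((1 - 1 / α) * (2 / p)) f z| ^ p ≤
              C ^ p *
                (AdamsKrylov.morreyNorm d α q (fun z => ‖b z‖ ^ (1 / (α - 1)))).toReal ^ (α - 1) *
                (eLpNorm f (ENNReal.ofReal p) volume).toReal ^ p) := by
  obtain ⟨C, hC, h⟩ :=
    proposition1_general (E := EuclideanSpace ℝ (Fin d)) d α hα1 q (by linarith) p hp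
  exact ⟨C, hC, fun b hb f hfc hfs => h b hb f (hfc.memLp_of_hasCompactSupport hfs)⟩
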